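/- Conventions. Functions and morphisms are composed from left to right. A semigroup $S$ is \emph{regular} if for every $a\in S$ there is $b$ with $aba=a$, $bab=b$; it is \emph{inverse} if such a $b$ is always unique; a regular semigroup $S$ is \emph{locally inverse} if $eSe$ is an inverse semigroup for every $e$ in the set $E(S)$ of idempotents of $S$. A \emph{category with subobjects} is a small category $\mathcal C$ with a distinguished subcategory on all objects, whose morphisms are called \emph{inclusions} (write $a\subseteq b$ if there is an inclusion $\iota(a,b)\colon a\to b$), which is a preorder whose only isomorphisms are identities, such that inclusions are monomorphisms of $\mathcal C$ and $\alpha$ is an inclusion whenever $\psi$ and $\alpha\psi$ are. A \emph{retraction} is a morphism $\theta\colon c\to c'$ with $\iota(c',c)\theta=1_{c'}$ for some inclusion $\iota(c',c)$. A \emph{normal factorisation} of $\varphi$ is $\varphi=\theta\sigma\iota$ with $\theta$ a retraction, $\sigma$ an isomorphism, $\iota$ an inclusion; then $\varphi^\circ:=\theta\sigma$. A \emph{normal cone} $\gamma$ with apex $c_\gamma$ is a family of morphisms $\gamma(a)\colon a\to c_\gamma$, one for each object $a$, with $\iota(a,b)\gamma(b)=\gamma(a)$ for $a\subseteq b$ and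 with at least one component an isomorphism. $\mathcal C$ is \emph{unambiguous} if, moreover, every inclusion $\iota(c',c)$ has exactly one $\theta$ with $\iota(c',c)\theta=1_{c'}$, every morphism has exactly one normal factorisation, and for every object $c$ there is a normal cone $\mu$ with $\mu(c)=1_c$. Let $\mathcal C$ be unambiguous. For a normal cone $\gamma$ and an epimorphism $\varphi$ from $c_\gamma$, let $\gamma*\varphi$ be the normal cone $a\mapsto\gamma(a)\varphi$; normal cones are multiplied by $\gamma\cdot\delta=\gamma*(\delta(c_\gamma))^\circ$. For an idempotent normal cone $\mu$ let $H(\mu;-)\colon\mathcal C\to\mathbf{Set}$ be the functor $H(\mu;c)=\{\mu*f^\circ: f\in\mathcal C(c_\mu,c)\}$, $H(\mu;g)\colon\mu*f^\circ\mapsto\mu*(fg)^\circ$, let $\eta_\mu\colon H(\mu;-)\to\mathcal C(c_\mu,-)$, $\mu*f^\circ\mapsto f$, be the associated natural isomorphism, and let $MH(\mu;-)=\{c:\mu(c)\text{ is an isomorphism}\}$. The \emph{unambiguous dual} $\mathcal C^*$ is the full subcategory of $[\mathcal C,\mathbf{Set}]$ on the functors $H(\mu;-)$, $\mu$ an idempotent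 normal cone; its inclusions are the natural transformations all of whose components are inclusions of sets. A \emph{local isomorphism} is a functor $F$ between unambiguous categories that preserves inclusions, is fully faithful, and for each object $c$ restricts to an isomorphism of the full subcategory on $\{d: d\subseteq c\}$ onto the full subcategory on $\{d: d\subseteq F(c)\}$. A \emph{cross-connection} between unambiguous categories $\mathcal C$ and $\mathcal D$ is a quadruple $(\mathcal C,\mathcal D;\Gamma,\Delta)$ of local isomorphisms $\Gamma\colon\mathcal D\to\mathcal C^*$, $\Delta\colon\mathcal C\to\mathcal D^*$ such that $c\in M\Gamma(d)\iff d\in M\Delta(c)$ for all objects $c$ of $\mathcal C$ and $d$ of $\mathcal D$. For a regular semigroup $S$, the category $\mathbb L(S)$ has the sets $Se$ ($e\in E(S)$) as objects and the maps $\rho(e,u,f)\colon Se\to Sf$, $x\mapsto xu$ ($u\in eSf$) as morphisms; its inclusions are the inclusion maps of sets. Dually, $\mathbb R(S)$ has the sets $eS$ as objects and the maps $\lambda(e,u,f)\colon eS\to fS$, $x\mapsto ux$ ($u\in fSe$) as morphisms. For $e\in E(S)$ let $\rho^e$ be the normal cone in $\mathbb L(S)$ with apex $Se$ and $\rho^e(Sg)=\rho(g,ge,e)$,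 and let $\lambda^e$ be the normal cone in $\mathbb R(S)$ with apex $eS$ and $\lambda^e(gS)=\lambda(g,eg,e)$. \textbf{Theorem.} Let $S$ be a locally inverse semigroup. Then $\mathbb L(S)$ and $\mathbb R(S)$ are unambiguous categories, the rules $$\Gamma_S(eS)=H(\rho^e;-),\qquad \Gamma_S(\lambda(e,u,f))=\eta_{\rho^e}\,\mathbb L(S)(\rho(f,u,e),-)\,\eta_{\rho^f}^{-1},$$ $$\Delta_S(Se)=H(\lambda^e;-),\qquad \Delta_S(\rho(e,u,f))=\eta_{\lambda^e}\,\mathbb R(S)(\lambda(f,u,e),-)\,\eta_{\lambda^f}^{-1}$$ give well-defined functors $\Gamma_S\colon\mathbb R(S)\to\mathbb L(S)^*$ and $\Delta_S\colon\mathbb L(S)\to\mathbb R(S)^*$, and $\Omega S=(\mathbb L(S),\mathbb R(S);\Gamma_S,\Delta_S)$ is a cross-connection between $\mathbb L(S)$ and $\mathbb R(S)$ (in particular, $\mathbb L(S)^*$ and $\mathbb R(S)^*$ are unambiguous). -/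

import Mathlib

open CategoryTheory MulOpposite

universe u

namespace CrossConn

noncomputable section

/-! ### Regular, inverse and locally inverse semigroups -/

/-- `a` and `b` are mutually inverse elements. -/
def AreInverse {S : Type u} [Semigroup S] (a b : S) : Prop :=
  a * b * a = a ∧ b * a * b = b

/-- Every element has an inverse. -/
def IsRegularSemigroup (S : Type u) [Semigroup S] : Prop :=
  ∀ a : S, ∃ b : S, AreInverse a b

/-- Every element has a unique inverse. -/
def IsInverseSemigroup (S : Type u) [Semigroup S] : Prop :=
  ∀ a : S, ∃! b : S, AreInverse a b

/-- A regular semigroup in which every local subsemigroup `eSe` is an inverse semigroup. -/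
def IsLocallyInverseSemigroup (S : Type u) [Semigroup S] : Prop :=
  IsRegularSemigroup S ∧
    ∀ e : S, IsIdempotentElem e → IsInverseSemigroup (Subsemigroup.corner e)

/-! ### Categories with subobjects, normal factorisations, normal cones

Composition `≫` is written from left to right, as in `φψ`. -/

/-- A distinguished class of morphisms of `C`, called inclusions.  (Only data; the axioms are in
`IsCategoryWithSubobjects`.) -/
class HasInclusions (C : Type u) [SmallCategory C] where
  IsInclusion : ∀ {a b : C}, (a ⟶ b) → Prop

section Categories

variable (C : Type u) [SmallCategory C] [HasInclusions C]

/-- The inclusions form a subcategory with the same objects which is a strict preorder, every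
inclusion is a monomorphism, and `α ψ`, `ψ` inclusions imply that `α` is an inclusion. -/
class IsCategoryWithSubobjects : Prop where
  id_mem : ∀ a : C, HasInclusions.IsInclusion (𝟙 a)
  comp_mem : ∀ {a b c : C} (φ : a ⟶ b) (ψ : b ⟶ c), HasInclusions.IsInclusion φ →
    HasInclusions.IsInclusion ψ → HasInclusions.IsInclusion (φ ≫ ψ)
  thin : ∀ {a b : C} (φ ψ : a ⟶ b), HasInclusions.IsInclusion φ →
    HasInclusions.IsInclusion ψ → φ = ψ
  strict : ∀ {a b : C} (φ : a ⟶ b) (ψ : b ⟶ a), HasInclusions.IsInclusion φ →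
    HasInclusions.IsInclusion ψ → a = b
  mono : ∀ {a b : C} (φ : a ⟶ b), HasInclusions.IsInclusion φ → Mono φ
  left_mem : ∀ {a b c : C} (α : a ⟶ b) (ψ : b ⟶ c), HasInclusions.IsInclusion (α ≫ ψ) →
    HasInclusions.IsInclusion ψ → HasInclusions.IsInclusion α

variable {C}

/-- `a ⊆ b`: there is an inclusion from `a` to `b`. -/
def IsSubobject (a b : C) : Prop := ∃ i : a ⟶ b, HasInclusions.IsInclusion i

/-- `θ : c ⟶ c'` is a retraction: it splits an inclusion `c' ⟶ c`. -/
def IsRetraction {c c' : C} (θ : c ⟶ c') : Prop :=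
  ∃ i : c' ⟶ c, HasInclusions.IsInclusion i ∧ i ≫ θ = 𝟙 c'

/-- A normal factorisation `φ = θ σ ι` (retraction, isomorphism, inclusion). -/
structure NormalFactorisation {a b : C} (φ : a ⟶ b) where
  coim : C
  im : C
  θ : a ⟶ coim
  σ : coim ⟶ im
  ι : im ⟶ b
  retraction : IsRetraction θ
  iso : IsIso σ
  inclusion : HasInclusions.IsInclusion ι
  fac : θ ≫ σ ≫ ι = φ

variable (C) in
/-- A normal cone in `C`, with its apex. -/
structure NormalCone where
  apex : C
  comp : ∀ a : C, a ⟶ apex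
  inclusion_comp : ∀ {a b : C} (i : a ⟶ b), HasInclusions.IsInclusion i → i ≫ comp b = comp a
  exists_iso : ∃ c : C, IsIso (comp c)

variable (C) in
/-- Unambiguous categories. -/
class IsUnambiguous : Prop extends IsCategoryWithSubobjects C where
  splits_uniquely : ∀ {a b : C} (i : a ⟶ b), HasInclusions.IsInclusion i →
    ∃! θ : b ⟶ a, i ≫ θ = 𝟙 a
  unique_factorisation : ∀ {a b : C} (φ : a ⟶ b), Nonempty (Unique (NormalFactorisation φ))
  exists_cone : ∀ c : C, ∃ μ : NormalCone C, μ.apex = c ∧ μ.comp μ.apex = 𝟙 μ.apex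

/-- The ideal `(c)`: the full subcategory on the objects `d ⊆ c`. -/
abbrev Ideal (c : C) : Type u :=
  ObjectProperty.FullSubcategory (fun d : C => IsSubobject d c)

variable {D : Type u} [SmallCategory D] [HasInclusions D]

/-- `F` maps inclusions to inclusions. -/
def PreservesInclusions (F : C ⥤ D) : Prop :=
  ∀ {a b : C} (i : a ⟶ b), HasInclusions.IsInclusion i → HasInclusions.IsInclusion (F.map i)

/-- The restriction of an inclusion preserving functor `F` to a functor from the ideal `(c)` to
the ideal `(F(c))`. -/
def restrictIdeal (F : C ⥤ D) (hF : PreservesInclusions F) (c : C) : Ideal c ⥤ Ideal (F.obj c) :=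
  ObjectProperty.lift _ (ObjectProperty.ι _ ⋙ F) (fun d => by
    obtain ⟨i, hi⟩ := d.property
    exact ⟨F.map i, hF i hi⟩)

/-- `F` is an isomorphism of categories. -/
def IsCatIso {A B : Type u} [SmallCategory A] [SmallCategory B] (F : A ⥤ B) : Prop :=
  ∃ G : B ⥤ A, F ⋙ G = 𝟭 A ∧ G ⋙ F = 𝟭 B

/-- A local isomorphism between two unambiguous categories. -/
structure IsLocalIsomorphism (F : C ⥤ D) : Prop where
  source_unambiguous : IsUnambiguous C
  target_unambiguous : IsUnambiguous D
  preservesInclusions : PreservesInclusions F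
  full : F.Full
  faithful : F.Faithful
  isCatIso_restrict : ∀ c : C, IsCatIso (restrictIdeal F preservesInclusions c)

end Categories

/-! ### The semigroup of normal cones of an unambiguous category -/

section Cones

variable {C : Type u} [SmallCategory C] [HasInclusions C] [IsUnambiguous C]

/-- The normal factorisation of `φ`. -/
def normalFact {a b : C} (φ : a ⟶ b) : NormalFactorisation φ :=
  (Classical.choice (IsUnambiguous.unique_factorisation φ)).default

lemma normalFact_unique {a b : C} {φ : a ⟶ b} (F : NormalFactorisation φ) : F = normalFact φ :=
  (Classical.choice (IsUnambiguous.unique_factorisation φ)).uniq F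

/-- The image of `φ`. -/
abbrev image {a b : C} (φ : a ⟶ b) : C := (normalFact φ).im

/-- The epimorphic component `φ° = θσ` of `φ = θσι`. -/
def epiComp {a b : C} (φ : a ⟶ b) : a ⟶ image φ := (normalFact φ).θ ≫ (normalFact φ).σ

lemma epiComp_fac {a b : C} (φ : a ⟶ b) : epiComp φ ≫ (normalFact φ).ι = φ := by
  rw [epiComp, Category.assoc]
  exact (normalFact φ).fac

instance epi_epiComp {a b : C} (φ : a ⟶ b) : Epi (epiComp φ) := by
  obtain ⟨i, -, hi⟩ := (normalFact φ).retraction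
  have h1 : Epi (normalFact φ).θ := by
    have : Epi (i ≫ (normalFact φ).θ) := by rw [hi]; infer_instance
    exact epi_of_epi i _
  have h2 : IsIso (normalFact φ).σ := (normalFact φ).iso
  exact epi_comp _ _

/-- An inclusion which is an epimorphism is an isomorphism. -/
lemma isIso_of_inclusion_of_epi {a b : C} (i : a ⟶ b) (hi : HasInclusions.IsInclusion i)
    [Epi i] : IsIso i := by
  obtain ⟨θ, hθ, -⟩ := IsUnambiguous.splits_uniquely i hi
  refine ⟨θ, hθ, ?_⟩
  rw [← cancel_epi i, ← Category.assoc, hθ, Category.id_comp, Category.comp_id]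

namespace NormalCone

/-- The cone `γ ∗ φ : c ↦ γ(c) φ`, for an epimorphism `φ` out of the apex of `γ`. -/
def star (γ : NormalCone C) {d : C} (φ : γ.apex ⟶ d) [Epi φ] : NormalCone C where
  apex := d
  comp a := γ.comp a ≫ φ
  inclusion_comp i hi := by rw [← Category.assoc, γ.inclusion_comp i hi]
  exists_iso := by
    obtain ⟨c, hc⟩ := γ.exists_iso
    let F := normalFact (γ.comp c ≫ φ)
    obtain ⟨i, hi, hiθ⟩ := F.retraction
    have hσ : IsIso F.σ := F.iso
    have hepi : Epi F.ι := by
      have h : Epi ((F.θ ≫ F.σ) ≫ F.ι) := by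
        rw [Category.assoc, F.fac]; infer_instance
      exact epi_of_epi (F.θ ≫ F.σ) F.ι
    have hι : IsIso F.ι := isIso_of_inclusion_of_epi F.ι F.inclusion
    refine ⟨F.coim, ?_⟩
    have h : γ.comp F.coim ≫ φ = F.σ ≫ F.ι := by
      have hfac : i ≫ F.θ ≫ F.σ ≫ F.ι = i ≫ γ.comp c ≫ φ := congrArg (i ≫ ·) F.fac
      rw [← γ.inclusion_comp i hi, Category.assoc, ← hfac, ← Category.assoc i, hiθ,
        Category.id_comp]
    rw [h]
    infer_instance

/-- The product `γ · δ = γ ∗ (δ(c_γ))°` of normal cones. -/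
instance : Mul (NormalCone C) where
  mul γ δ := γ.star (epiComp (δ.comp γ.apex))

lemma mul_def (γ δ : NormalCone C) : γ * δ = γ.star (epiComp (δ.comp γ.apex)) := rfl

lemma star_eq_self_cancel (μ : NormalCone C) {d : C} (φ : μ.apex ⟶ d) [Epi φ]
    (h : μ.star φ = μ) : ∃ e : d = μ.apex, φ ≫ eqToHom e = 𝟙 μ.apex := by
  have e : d = μ.apex := congrArg apex h
  subst e
  refine ⟨rfl, ?_⟩
  have hc : ∀ a, μ.comp a ≫ φ = μ.comp a := by
    have h2 := (NormalCone.mk.injEq _ _ _ _ _ _ _ _).mp h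
    intro a
    exact congrFun (eq_of_heq h2.2) a
  obtain ⟨c, hc'⟩ := μ.exists_iso
  simpa using (cancel_epi (μ.comp c)).mp ((hc c).trans (Category.comp_id _).symm)

/-- An idempotent cone has the identity as its component at the apex. -/
lemma comp_apex_of_idem (μ : NormalCone C) (hμ : IsIdempotentElem μ) :
    μ.comp μ.apex = 𝟙 μ.apex := by
  obtain ⟨e, he⟩ := star_eq_self_cancel μ _ ((mul_def μ μ).symm.trans hμ)
  have key : ∀ {d : C} (e : d = μ.apex) (i : d ⟶ μ.apex), HasInclusions.IsInclusion i →
      i = eqToHom e := by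
    intro d e i hi
    subst e
    exact IsCategoryWithSubobjects.thin _ _ hi (IsCategoryWithSubobjects.id_mem _)
  rw [← epiComp_fac (μ.comp μ.apex), key e _ (normalFact _).inclusion, he]

lemma star_congr (μ : NormalCone C) {d d' : C} (φ : μ.apex ⟶ d) (φ' : μ.apex ⟶ d') [Epi φ]
    [Epi φ'] (e : d = d') (h : φ ≫ eqToHom e = φ') : μ.star φ = μ.star φ' := by
  subst e
  have h : φ = φ' := by simpa using h
  subst h
  rfl

lemma star_id (μ : NormalCone C) : μ.star (𝟙 μ.apex) = μ := by
  cases μ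
  simp [star]

/-- The epimorphic component of an identity is that identity. -/
lemma epiComp_id (a : C) : ∃ e : image (𝟙 a) = a, epiComp (𝟙 a) ≫ eqToHom e = 𝟙 a := by
  let F : NormalFactorisation (𝟙 a) :=
    { coim := a, im := a, θ := 𝟙 a, σ := 𝟙 a, ι := 𝟙 a
      retraction := ⟨𝟙 a, IsCategoryWithSubobjects.id_mem a, Category.comp_id _⟩
      iso := inferInstance
      inclusion := IsCategoryWithSubobjects.id_mem a
      fac := by simp }
  have h : ∀ G : NormalFactorisation (𝟙 a), F = G →
      ∃ e : G.im = a, (G.θ ≫ G.σ) ≫ eqToHom e = 𝟙 a := by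
    rintro G rfl
    exact ⟨rfl, by simp [F]⟩
  exact h _ (normalFact_unique F)

lemma idem_of_comp_apex (μ : NormalCone C) (h : μ.comp μ.apex = 𝟙 μ.apex) :
    IsIdempotentElem μ := by
  obtain ⟨e, he⟩ := epiComp_id μ.apex
  have h1 : ∀ ψ : μ.apex ⟶ μ.apex, ψ = 𝟙 μ.apex →
      μ.star (epiComp ψ) = μ.star (𝟙 μ.apex) := by
    rintro ψ rfl
    exact star_congr μ _ _ e he
  exact (h1 _ h).trans (star_id μ)

/-! ### `H`-functors -/

/-- The set `H(μ; c) = {μ ∗ f° : f ∈ C(c_μ, c)}`. -/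
def hSet (μ : NormalCone C) (c : C) : Set (NormalCone C) :=
  {γ | ∃ f : μ.apex ⟶ c, γ = μ.star (epiComp f)}

lemma star_epiComp_injective (μ : NormalCone C) (hμ : IsIdempotentElem μ) {c : C}
    (f g : μ.apex ⟶ c) (h : μ.star (epiComp f) = μ.star (epiComp g)) : f = g := by
  have hid := comp_apex_of_idem μ hμ
  have key : ∀ {d d' : C} (φ : μ.apex ⟶ d) (φ' : μ.apex ⟶ d') [Epi φ] [Epi φ']
      (i : d ⟶ c) (i' : d' ⟶ c), HasInclusions.IsInclusion i → HasInclusions.IsInclusion i' →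
      μ.star φ = μ.star φ' → φ ≫ i = φ' ≫ i' := by
    intro d d' φ φ' _ _ i i' hi hi' hs
    have e : d = d' := congrArg apex hs
    subst e
    have h2 := (NormalCone.mk.injEq _ _ _ _ _ _ _ _).mp hs
    have h3 : μ.comp μ.apex ≫ φ = μ.comp μ.apex ≫ φ' := congrFun (eq_of_heq h2.2) μ.apex
    rw [hid, Category.id_comp, Category.id_comp] at h3
    rw [h3, IsCategoryWithSubobjects.thin i i' hi hi']
  have := key _ _ _ _ (normalFact f).inclusion (normalFact g).inclusion h
  rwa [epiComp_fac, epiComp_fac] at this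

/-- The bijection `f ↦ μ ∗ f°` of `C(c_μ, c)` onto `H(μ; c)`, for an idempotent cone `μ`; its
inverse is the component at `c` of the natural isomorphism `η_μ : H(μ; -) ⟶ C(c_μ, -)`. -/
def hEquiv (μ : NormalCone C) (hμ : IsIdempotentElem μ) (c : C) :
    (μ.apex ⟶ c) ≃ hSet μ c :=
  Equiv.ofBijective (fun f => ⟨μ.star (epiComp f), f, rfl⟩)
    ⟨fun f g h => star_epiComp_injective μ hμ f g (congrArg Subtype.val h),
      fun ⟨_, f, hf⟩ => ⟨f, Subtype.ext hf.symm⟩⟩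

end NormalCone

end Cones

/-- The category of subsets of a fixed set `U` and all maps between them: a full subcategory of
the category of sets, in which equality of objects is equality of sets. -/
structure SubsetCat (U : Type u) where
  carrier : Set U

instance (U : Type u) : SmallCategory (SubsetCat U) where
  Hom A B := A.carrier → B.carrier
  id _ := fun x => x
  comp f g := fun x => g (f x)

section Dual

variable {C : Type u} [SmallCategory C] [HasInclusions C] [IsUnambiguous C]

/-- The functor `H(μ; -)` of an idempotent cone `μ`; `H(μ; g)` sends `μ ∗ f°` to `μ ∗ (f g)°`. -/
def hFunctor (μ : NormalCone C) (hμ : IsIdempotentElem μ) : C ⥤ SubsetCat (NormalCone C) where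
  obj c := ⟨μ.hSet c⟩
  map {c d} g := fun x => μ.hEquiv hμ d ((μ.hEquiv hμ c).symm x ≫ g)
  map_id c := by
    funext x
    show μ.hEquiv hμ c ((μ.hEquiv hμ c).symm x ≫ 𝟙 c) = x
    simp
  map_comp {c d e} g h := by
    funext x
    show μ.hEquiv hμ e ((μ.hEquiv hμ c).symm x ≫ g ≫ h) =
      μ.hEquiv hμ e ((μ.hEquiv hμ d).symm (μ.hEquiv hμ d ((μ.hEquiv hμ c).symm x ≫ g)) ≫ h)
    simp

lemma hFunctor_map_star (μ : NormalCone C) (hμ : IsIdempotentElem μ) {c d : C} (g : c ⟶ d)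
    (f : μ.apex ⟶ c) :
    (hFunctor μ hμ).map g ⟨μ.star (epiComp f), f, rfl⟩ =
      (⟨μ.star (epiComp (f ≫ g)), f ≫ g, rfl⟩ : μ.hSet d) := by
  show μ.hEquiv hμ d ((μ.hEquiv hμ c).symm (μ.hEquiv hμ c f) ≫ g) = μ.hEquiv hμ d (f ≫ g)
  simp

variable (C) in
/-- The unambiguous dual `C*`: the full subcategory of set-valued functors on `C` whose objects
are the functors `H(μ; -)` with `μ` an idempotent normal cone. -/
abbrev Dual : Type u :=
  ObjectProperty.FullSubcategory (fun X : C ⥤ SubsetCat (NormalCone C) =>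
    ∃ (μ : NormalCone C) (hμ : IsIdempotentElem μ), X = hFunctor μ hμ)

/-- The inclusions of `C*` are the natural transformations all of whose components are inclusions
of sets. -/
instance : HasInclusions (Dual C) where
  IsInclusion {X Y} τ := ∀ (c : C) (x : (X.obj.obj c).carrier),
    ((τ.hom.app c x : (Y.obj.obj c).carrier) : NormalCone C) = (x : NormalCone C)

/-- `H(μ; -)` as an object of the dual. -/
def Dual.H (μ : NormalCone C) (hμ : IsIdempotentElem μ) : Dual C :=
  ⟨hFunctor μ hμ, μ, hμ, rfl⟩

/-- For `g : c_ν ⟶ c_μ`, the natural transformation `η_μ C(g, -) η_ν⁻¹` from `H(μ; -)` to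
`H(ν; -)`. -/
def Dual.homOf (μ ν : NormalCone C) (hμ : IsIdempotentElem μ) (hν : IsIdempotentElem ν)
    (g : ν.apex ⟶ μ.apex) : Dual.H μ hμ ⟶ Dual.H ν hν :=
  ObjectProperty.homMk
    { app := fun c x => ν.hEquiv hν c (g ≫ (μ.hEquiv hμ c).symm x)
      naturality := by
        intro c d h
        funext x
        show ν.hEquiv hν d (g ≫ (μ.hEquiv hμ d).symm
            (μ.hEquiv hμ d ((μ.hEquiv hμ c).symm x ≫ h))) =
          ν.hEquiv hν d ((ν.hEquiv hν c).symm
            (ν.hEquiv hν c (g ≫ (μ.hEquiv hμ c).symm x)) ≫ h)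
        simp }

/-- The `M`-set of an object `X = H(μ; -)` of the dual: the objects `c` such that `μ(c)` is an
isomorphism. -/
def Dual.MSet (X : Dual C) : Set C :=
  {c | ∃ (μ : NormalCone C) (hμ : IsIdempotentElem μ), X = Dual.H μ hμ ∧ IsIso (μ.comp c)}

end Dual

/-- `(C, D; Γ, Δ)` is a cross-connection of the unambiguous categories `C` and `D`.  (That `C`,
`D` and the duals are unambiguous is part of `IsLocalIsomorphism`.) -/
structure IsCrossConnection (C D : Type u) [SmallCategory C] [HasInclusions C] [IsUnambiguous C]
    [SmallCategory D] [HasInclusions D] [IsUnambiguous D] (Γ : D ⥤ Dual C) (Δ : C ⥤ Dual D) :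
    Prop where
  left_local : IsLocalIsomorphism Γ
  right_local : IsLocalIsomorphism Δ
  mem_mSet_iff : ∀ (c : C) (d : D), c ∈ (Γ.obj d).MSet ↔ d ∈ (Δ.obj c).MSet

/-! ### The categories of principal one-sided ideals -/

section LR

/-- The principal left ideal `Se`. -/
def principalLeft {S : Type u} [Semigroup S] (e : S) : Set S := {x | ∃ s : S, x = s * e}

/-- The set `eSf`. -/
def sandwich {S : Type u} [Semigroup S] (e f : S) : Set S := {u | ∃ s : S, u = e * s * f}

/-- The objects of `𝕃(S)`: the sets `Se` with `e` idempotent. -/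
structure LCat (S : Type u) [Semigroup S] where
  carrier : Set S
  exists_generator : ∃ e : S, IsIdempotentElem e ∧ carrier = principalLeft e

variable {S : Type u} [Semigroup S]

/-- The morphisms of `𝕃(S)` are the maps `ρ(e,u,f) : Se → Sf`, `x ↦ x u`, with `u ∈ eSf`. -/
instance : SmallCategory (LCat S) where
  Hom A B := {φ : A.carrier → B.carrier // ∃ e u f : S, IsIdempotentElem e ∧
    IsIdempotentElem f ∧ A.carrier = principalLeft e ∧ B.carrier = principalLeft f ∧
    u ∈ sandwich e f ∧ ∀ x, (φ x : S) = x * u}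
  id A := ⟨fun x => x, by
    obtain ⟨e, he, hA⟩ := A.exists_generator
    refine ⟨e, e, e, he, he, hA, hA, ⟨e, by rw [he.eq, he.eq]⟩, fun x => ?_⟩
    obtain ⟨s, hs⟩ : (x : S) ∈ principalLeft e := hA ▸ x.2
    rw [hs, mul_assoc, he.eq]⟩
  comp {A B D} φ ψ := ⟨fun x => ψ.1 (φ.1 x), by
    obtain ⟨e, u, f, he, hf, hA, hB, ⟨s, rfl⟩, hφ⟩ := φ.2
    obtain ⟨g, v, h, hg, hh, hB', hD, ⟨t, rfl⟩, hψ⟩ := ψ.2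
    refine ⟨e, (e * s * f) * (g * t * h), h, he, hh, hA, hD, ⟨s * f * g * t, ?_⟩, fun x => ?_⟩
    · simp only [mul_assoc]
    · rw [hψ, hφ, mul_assoc]⟩

instance : HasInclusions (LCat S) where
  IsInclusion φ := ∀ x, (φ.1 x : S) = x

/-- The object `Se` of `𝕃(S)`. -/
def LCat.of (e : S) (he : IsIdempotentElem e) : LCat S := ⟨principalLeft e, e, he, rfl⟩

/-- The morphism `ρ(e,u,f) : Se → Sf`. -/
def LCat.rho {e f : S} (he : IsIdempotentElem e) (hf : IsIdempotentElem f) (u : S)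
    (hu : u ∈ sandwich e f) : LCat.of e he ⟶ LCat.of f hf :=
  ⟨fun x => ⟨x.1 * u, by
    obtain ⟨s, rfl⟩ := hu
    exact ⟨x.1 * (e * s), (mul_assoc _ _ _).symm⟩⟩,
    e, u, f, he, hf, rfl, rfl, hu, fun _ => rfl⟩

/-- The principal cone `ρ^e` of an idempotent `e`, with apex `Se`; its component at `Sg` is
`ρ(g, ge, e)`, that is, `x ↦ x (ge) = x e`. -/
def LCat.rhoCone (e : S) (he : IsIdempotentElem e) : NormalCone (LCat S) where
  apex := LCat.of e he
  comp A := ⟨fun x => ⟨x.1 * e, x.1, rfl⟩, by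
    obtain ⟨g, hg, hA⟩ := A.exists_generator
    refine ⟨g, g * e, e, hg, he, hA, rfl, ⟨g, by rw [hg.eq]⟩, fun x => ?_⟩
    obtain ⟨s, hs⟩ : (x : S) ∈ principalLeft g := hA ▸ x.2
    show (x : S) * e = x * (g * e)
    rw [hs, ← mul_assoc, mul_assoc s g g, hg.eq]⟩
  inclusion_comp i hi := by
    apply Subtype.ext
    funext x
    exact Subtype.ext (congrArg (· * e) (hi x))
  exists_iso := by
    refine ⟨LCat.of e he, ?_⟩
    have h : ∀ φ : LCat.of e he ⟶ LCat.of e he, (∀ x, (φ.1 x : S) = x) → IsIso φ := by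
      intro φ hφ
      have : φ = 𝟙 (LCat.of e he) := Subtype.ext (funext fun x => Subtype.ext (hφ x))
      rw [this]
      infer_instance
    apply h
    rintro ⟨x, s, rfl⟩
    show s * e * e = s * e
    rw [mul_assoc, he.eq]

lemma LCat.rhoCone_comp_of (e : S) (he : IsIdempotentElem e) (g : S) (hg : IsIdempotentElem g) :
    (LCat.rhoCone e he).comp (LCat.of g hg) =
      LCat.rho hg he (g * e) ⟨g, by rw [hg.eq]⟩ := by
  apply Subtype.ext
  funext x
  apply Subtype.ext
  obtain ⟨x, s, rfl⟩ := x
  show s * g * e = s * g * (g * e)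
  rw [← mul_assoc, mul_assoc s g g, hg.eq]

lemma LCat.rhoCone_idem [IsUnambiguous (LCat S)] (e : S) (he : IsIdempotentElem e) :
    IsIdempotentElem (LCat.rhoCone e he) := by
  apply NormalCone.idem_of_comp_apex
  apply Subtype.ext
  funext x
  apply Subtype.ext
  obtain ⟨x, s, rfl⟩ := x
  show s * e * e = s * e
  rw [mul_assoc, he.eq]

lemma isIdempotentElem_op {e : S} (he : IsIdempotentElem e) : IsIdempotentElem (op e) :=
  congrArg op he

variable (S) in
/-- The category `ℝ(S)` of principal right ideals of `S`, that is, of principal left ideals of the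
opposite semigroup: its objects are the sets `eS` with `e` idempotent and its morphisms the maps
`λ(e,u,f) : eS → fS`, `x ↦ u x`, with `u ∈ fSe`. -/
abbrev RCat : Type u := LCat Sᵐᵒᵖ

/-- The object `eS` of `ℝ(S)`. -/
def RCat.of (e : S) (he : IsIdempotentElem e) : RCat S :=
  LCat.of (op e) (isIdempotentElem_op he)

lemma RCat.mem_of (e : S) (he : IsIdempotentElem e) (x : S) :
    op x ∈ (RCat.of e he).carrier ↔ ∃ s : S, x = e * s :=
  ⟨fun ⟨s, hs⟩ => ⟨unop s, congrArg unop hs⟩, fun ⟨s, hs⟩ => ⟨op s, congrArg op hs⟩⟩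

lemma op_mem_sandwich {e f u : S} (hu : u ∈ sandwich f e) : op u ∈ sandwich (op e) (op f) := by
  obtain ⟨s, rfl⟩ := hu
  exact ⟨op s, by simp only [← op_mul, mul_assoc]⟩

/-- The morphism `λ(e,u,f) : eS → fS`. -/
def RCat.lam {e f : S} (he : IsIdempotentElem e) (hf : IsIdempotentElem f) (u : S)
    (hu : u ∈ sandwich f e) : RCat.of e he ⟶ RCat.of f hf :=
  LCat.rho (isIdempotentElem_op he) (isIdempotentElem_op hf) (op u) (op_mem_sandwich hu)

lemma RCat.lam_apply {e f : S} (he : IsIdempotentElem e) (hf : IsIdempotentElem f) (u : S)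
    (hu : u ∈ sandwich f e) (x : S) (hx : op x ∈ (RCat.of e he).carrier) :
    (((RCat.lam he hf u hu).1 ⟨op x, hx⟩ : (RCat.of f hf).carrier) : Sᵐᵒᵖ) = op (u * x) := rfl

/-- The principal cone `λ^e` in `ℝ(S)`, with apex `eS` and components `x ↦ e x`. -/
def RCat.lamCone (e : S) (he : IsIdempotentElem e) : NormalCone (RCat S) :=
  LCat.rhoCone (op e) (isIdempotentElem_op he)

lemma RCat.lamCone_idem [IsUnambiguous (RCat S)] (e : S) (he : IsIdempotentElem e) :
    IsIdempotentElem (RCat.lamCone e he) :=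
  LCat.rhoCone_idem (op e) (isIdempotentElem_op he)

/-- `Γ` is the functor `Γ_S : ℝ(S) ⥤ 𝕃(S)*`: for all idempotents, `Γ(eS) = H(ρ^e; -)` and
`Γ(λ(e,u,f)) = η_{ρ^e} 𝕃(S)(ρ(f,u,e), -) η_{ρ^f}⁻¹`.  This determines `Γ` completely. -/
def IsGamma [IsUnambiguous (LCat S)] (Γ : RCat S ⥤ Dual (LCat S)) : Prop :=
  ∃ hobj : ∀ (e : S) (he : IsIdempotentElem e),
      Γ.obj (RCat.of e he) = Dual.H (LCat.rhoCone e he) (LCat.rhoCone_idem e he),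
    ∀ (e f : S) (he : IsIdempotentElem e) (hf : IsIdempotentElem f) (u : S)
      (hu : u ∈ sandwich f e),
      Γ.map (RCat.lam he hf u hu) =
        eqToHom (hobj e he) ≫
          Dual.homOf (LCat.rhoCone e he) (LCat.rhoCone f hf) (LCat.rhoCone_idem e he)
            (LCat.rhoCone_idem f hf) (LCat.rho hf he u hu) ≫
          eqToHom (hobj f hf).symm

/-- `Δ` is the functor `Δ_S : 𝕃(S) ⥤ ℝ(S)*`: for all idempotents, `Δ(Se) = H(λ^e; -)` and
`Δ(ρ(e,u,f)) = η_{λ^e} ℝ(S)(λ(f,u,e), -) η_{λ^f}⁻¹`.  This determines `Δ` completely. -/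
def IsDelta [IsUnambiguous (RCat S)] (Δ : LCat S ⥤ Dual (RCat S)) : Prop :=
  ∃ hobj : ∀ (e : S) (he : IsIdempotentElem e),
      Δ.obj (LCat.of e he) = Dual.H (RCat.lamCone e he) (RCat.lamCone_idem e he),
    ∀ (e f : S) (he : IsIdempotentElem e) (hf : IsIdempotentElem f) (u : S)
      (hu : u ∈ sandwich e f),
      Δ.map (LCat.rho he hf u hu) =
        eqToHom (hobj e he) ≫
          Dual.homOf (RCat.lamCone e he) (RCat.lamCone f hf) (RCat.lamCone_idem e he)
            (RCat.lamCone_idem f hf) (RCat.lam hf he u hu) ≫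
          eqToHom (hobj f hf).symm

end LR

end

end CrossConn

/-! Everything is translated into equations between elements of `S`. A morphism `Se → Sf` is right
translation by a unique `u ∈ eSf`. An element `u` with inverse `v` has the normal factorisation
`(uv)·u·(vu)`. In a locally inverse semigroup the idempotents below a common idempotent commute
(`LocallyCommute`), and this forces uniqueness of retractions and of coimages; images are unique
because their generators are L-related to `u`. Regularity and `LocallyCommute` are left-right
symmetric, so `ℝ(S)`, being `𝕃` of the opposite semigroup, is unambiguous too.

The dual of any unambiguous category `C` is unambiguous. By a Yoneda argument, morphisms `H(μ;-) →
H(ν;-)` are morphisms `g : c_ν → c_μ` of `C`, and such a morphism is an inclusion exactly when `μ(a)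
= ν(a) g` for all `a` (`Dual.isInclusion_homOf_iff`). Normal factorisations in the dual are
therefore factorisations in `C` read backwards. Their uniqueness rests on the fact that in `C` split
monomorphisms have one left inverse and split epimorphisms one right inverse (`retraction_unique`,
`section_unique`).

Finally, `Γ_S` and `Δ_S` are two instances of one functor `LCat.toDual`, attached to an
anti-isomorphism `α : T ≃ S`. It is a local isomorphism because an idempotent cone below `ρ^{α(f)}`
is right multiplication by an idempotent `α(e)` with `ef = e`. The two `M`-sets match because both
memberships express the existence of an element R-related to one generator and L-related to the
other (`LCat.mem_MSet_toDual_iff`). -/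

namespace CrossConn

/-! ### Split monomorphisms and normal factorisations -/

section General

variable {C : Type u} [SmallCategory C] [HasInclusions C]

/-- Normal factorisations with the same intermediate objects agree, provided that inclusions
split uniquely. -/
lemma NormalFactorisation.ext_of_obj_eq [IsCategoryWithSubobjects C]
    (hs : ∀ {a b : C} (i : a ⟶ b), HasInclusions.IsInclusion i → ∃! θ : b ⟶ a, i ≫ θ = 𝟙 a)
    {a b : C} {φ : a ⟶ b} (F G : NormalFactorisation φ) (hc : F.coim = G.coim)
    (hi : F.im = G.im) : F = G := by
  obtain ⟨c, d, θ, σ, ι, ⟨i, hi1, hi2⟩, hσ, hι, hF⟩ := F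
  obtain ⟨c', d', θ', σ', ι', ⟨i', hi1', hi2'⟩, hσ', hι', hG⟩ := G
  dsimp at hc hi
  subst hc hi
  obtain rfl := IsCategoryWithSubobjects.thin i i' hi1 hi1'
  obtain rfl := (hs i hi1).unique hi2 hi2'
  obtain rfl := IsCategoryWithSubobjects.thin ι ι' hι hι'
  have hm := IsCategoryWithSubobjects.mono ι hι
  have h : σ = σ' := by
    have h1 : i ≫ θ ≫ σ ≫ ι = i ≫ θ ≫ σ' ≫ ι := by rw [hF, hG]
    rw [reassoc_of% hi2, reassoc_of% hi2] at h1
    exact (cancel_mono ι).mp h1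
  subst h
  rfl

variable [IsUnambiguous C]

/-- The image of a composite is a subobject of the image of its second factor. -/
lemma isSubobject_image_comp {a b c : C} (x : a ⟶ b) (g : b ⟶ c) :
    IsSubobject (image (x ≫ g)) (image g) := by
  -- Extending the inclusion of this factorisation by that of `g` gives a normal factorisation of `x
  -- ≫ g`, so uniqueness identifies the images.
  let F := normalFact (x ≫ epiComp g)
  let G : NormalFactorisation (x ≫ g) :=
    { coim := F.coim, im := F.im, θ := F.θ, σ := F.σ, ι := F.ι ≫ (normalFact g).ι
      retraction := F.retraction
      iso := F.iso
      inclusion := IsCategoryWithSubobjects.comp_mem _ _ F.inclusion (normalFact g).inclusion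
      fac := by
        have := F.fac =≫ (normalFact g).ι
        simpa [epiComp_fac] using this }
  have h : F.im = image (x ≫ g) := congrArg NormalFactorisation.im (normalFact_unique G)
  rw [← h]
  exact ⟨F.ι, F.inclusion⟩

/-- The epimorphic component of a split monomorphism is an isomorphism. -/
lemma isIso_epiComp_of_split {a b : C} (i : a ⟶ b) (p : b ⟶ a) (h : i ≫ p = 𝟙 a) :
    IsIso (epiComp i) := by
  have h1 : epiComp i ≫ (normalFact i).ι ≫ p = 𝟙 a := by
    rw [← Category.assoc, epiComp_fac, h]
  have : IsSplitMono (epiComp i) := ⟨⟨⟨_, h1⟩⟩⟩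
  exact isIso_of_epi_of_isSplitMono _

/-- A split monomorphism has only one left inverse. -/
lemma retraction_unique {a b : C} (i : a ⟶ b) (p q : b ⟶ a) (hp : i ≫ p = 𝟙 a)
    (hq : i ≫ q = 𝟙 a) : p = q := by
  have := isIso_epiComp_of_split i p hp
  -- A left inverse of `i` becomes, after the isomorphism `epiComp i`, a left inverse of the
  -- inclusion of its image, and that one is unique.
  have key : ∀ r : b ⟶ a, i ≫ r = 𝟙 a → (normalFact i).ι ≫ r ≫ epiComp i = 𝟙 _ := by
    intro r hr
    rw [← cancel_epi (epiComp i), ← Category.assoc, epiComp_fac, reassoc_of% hr, Category.comp_id]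
  exact (cancel_mono (epiComp i)).mp
    ((IsUnambiguous.splits_uniquely _ (normalFact i).inclusion).unique (key p hp) (key q hq))

/-- A split epimorphism has only one right inverse. -/
lemma section_unique {c d : C} (p : c ⟶ d) (i j : d ⟶ c) (hi : i ≫ p = 𝟙 d)
    (hj : j ≫ p = 𝟙 d) : i = j := by
  have key : ∀ {b b' : C} (e : d ⟶ b) (e' : d ⟶ b') (ι : b ⟶ c) (ι' : b' ⟶ c) [IsIso e]
      [IsIso e'], HasInclusions.IsInclusion ι → HasInclusions.IsInclusion ι' →
      e ≫ ι ≫ p = 𝟙 d → e' ≫ ι' ≫ p = 𝟙 d → e ≫ ι = e' ≫ ι' := by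
    intro b b' e e' ι ι' _ _ hι hι' h h'
    -- If `e ι` is a section of `p`, then `p = (p e) e⁻¹ 1` is a normal factorisation, with
    -- retraction `p e` split by `ι`. Uniqueness of the factorisation of `p` then recovers both `ι`
    -- and `e`.
    let fact : ∀ {b : C} (e : d ⟶ b) (ι : b ⟶ c) [IsIso e], HasInclusions.IsInclusion ι →
        e ≫ ι ≫ p = 𝟙 d → NormalFactorisation p := fun {b} e ι _ hι h =>
      { coim := b, im := d, θ := p ≫ e, σ := inv e, ι := 𝟙 d
        retraction := ⟨ι, hι, by
          rw [← cancel_epi e, reassoc_of% h, Category.comp_id]⟩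
        iso := inferInstance
        inclusion := IsCategoryWithSubobjects.id_mem d
        fac := by simp }
    have hF : fact e ι hι h = fact e' ι' hι' h' :=
      (normalFact_unique _).trans (normalFact_unique _).symm
    have hb : b = b' := congrArg NormalFactorisation.coim hF
    subst hb
    obtain rfl := IsCategoryWithSubobjects.thin ι ι' hι hι'
    have h2 := (NormalFactorisation.mk.injEq _ _ _ _ _ _ _ _ _ _ _ _ _ _ _ _ _ _).mp hF
    have h3 : inv e = inv e' := eq_of_heq h2.2.2.2.1
    have h4 : e = e' := by
      rw [← cancel_mono (inv e), IsIso.hom_inv_id, h3, IsIso.hom_inv_id]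
    rw [h4]
  have := isIso_epiComp_of_split i p hi
  have := isIso_epiComp_of_split j p hj
  rw [← epiComp_fac i, ← epiComp_fac j]
  refine key _ _ _ _ (normalFact i).inclusion (normalFact j).inclusion ?_ ?_
  · rw [← Category.assoc, epiComp_fac, hi]
  · rw [← Category.assoc, epiComp_fac, hj]

/-! ### The calculus of `H`-functors -/

/-- `μ ∗ f° = ν ∗ g°` holds if and only if `μ(a) f = ν(a) g` for all objects `a`. -/
lemma NormalCone.star_epiComp_eq_iff {μ ν : NormalCone C} (hμ : IsIdempotentElem μ)
    (hν : IsIdempotentElem ν) {d : C} (f : μ.apex ⟶ d) (g : ν.apex ⟶ d) :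
    μ.star (epiComp f) = ν.star (epiComp g) ↔ ∀ a, μ.comp a ≫ f = ν.comp a ≫ g := by
  constructor
  · have key : ∀ {b b' : C} (φ : μ.apex ⟶ b) (φ' : ν.apex ⟶ b') [Epi φ] [Epi φ']
        (i : b ⟶ d) (i' : b' ⟶ d), HasInclusions.IsInclusion i → HasInclusions.IsInclusion i' →
        μ.star φ = ν.star φ' → ∀ a, μ.comp a ≫ φ ≫ i = ν.comp a ≫ φ' ≫ i' := by
      intro b b' φ φ' _ _ i i' hi hi' hs a
      have e : b = b' := congrArg apex hs
      subst e
      have h2 := (NormalCone.mk.injEq _ _ _ _ _ _ _ _).mp hs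
      have h3 : μ.comp a ≫ φ = ν.comp a ≫ φ' := congrFun (eq_of_heq h2.2) a
      rw [reassoc_of% h3, IsCategoryWithSubobjects.thin i i' hi hi']
    intro h a
    have := key _ _ _ _ (normalFact f).inclusion (normalFact g).inclusion h a
    rwa [epiComp_fac, epiComp_fac] at this
  · intro h
    have key : ∀ {b b' : C} (φ : μ.apex ⟶ b) (φ' : ν.apex ⟶ b') [Epi φ] [Epi φ']
        (i : b ⟶ d) (i' : b' ⟶ d), HasInclusions.IsInclusion i → HasInclusions.IsInclusion i' →
        b = b' → (∀ a, μ.comp a ≫ φ ≫ i = ν.comp a ≫ φ' ≫ i') → μ.star φ = ν.star φ' := by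
      intro b b' φ φ' _ _ i i' hi hi' e hs
      subst e
      obtain rfl := IsCategoryWithSubobjects.thin i i' hi hi'
      have := IsCategoryWithSubobjects.mono i hi
      refine (NormalCone.mk.injEq _ _ _ _ _ _ _ _).mpr ⟨rfl, heq_of_eq (funext fun a => ?_)⟩
      rw [← cancel_mono i, Category.assoc, Category.assoc]
      exact hs a
    -- Evaluating at the two apices makes `f` and `g` factor through each other, so each image is a
    -- subobject of the other and they coincide.
    have h1 : f = ν.comp μ.apex ≫ g := by
      rw [← h, comp_apex_of_idem μ hμ, Category.id_comp]
    have h2 : g = μ.comp ν.apex ≫ f := by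
      rw [h, comp_apex_of_idem ν hν, Category.id_comp]
    refine key _ _ _ _ (normalFact f).inclusion (normalFact g).inclusion ?_ ?_
    · obtain ⟨i, hi⟩ : IsSubobject (image f) (image g) := by
        have := isSubobject_image_comp (ν.comp μ.apex) g
        rwa [← h1] at this
      obtain ⟨j, hj⟩ : IsSubobject (image g) (image f) := by
        have := isSubobject_image_comp (μ.comp ν.apex) f
        rwa [← h2] at this
      exact IsCategoryWithSubobjects.strict i j hi hj
    · intro a
      rw [epiComp_fac, epiComp_fac]
      exact h a

/-! ### The dual category: morphisms, inclusions, `M`-sets and unambiguity. -/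

namespace Dual

variable {μ ν κ : NormalCone C} (hμ : IsIdempotentElem μ) (hν : IsIdempotentElem ν)
  (hκ : IsIdempotentElem κ)

lemma homOf_app (g : ν.apex ⟶ μ.apex) (c : C) (f : μ.apex ⟶ c) :
    (homOf μ ν hμ hν g).hom.app c (μ.hEquiv hμ c f) = ν.hEquiv hν c (g ≫ f) := by
  show ν.hEquiv hν c (g ≫ (μ.hEquiv hμ c).symm (μ.hEquiv hμ c f)) = _
  simp

lemma hom_ext {X Y : Dual C} {σ τ : X ⟶ Y}
    (h : ∀ c (x : (X.obj.obj c).carrier), σ.hom.app c x = τ.hom.app c x) : σ = τ := by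
  apply ObjectProperty.hom_ext
  ext c
  exact funext (h c)

lemma homOf_ext {τ : H μ hμ ⟶ H ν hν} {g : ν.apex ⟶ μ.apex}
    (h : ∀ c (f : μ.apex ⟶ c), τ.hom.app c (μ.hEquiv hμ c f) = ν.hEquiv hν c (g ≫ f)) :
    τ = homOf μ ν hμ hν g := by
  refine hom_ext fun c x => ?_
  obtain ⟨f, rfl⟩ := (μ.hEquiv hμ c).surjective x
  rw [h, homOf_app]

lemma homOf_id : homOf μ μ hμ hμ (𝟙 _) = 𝟙 (H μ hμ) :=
  (homOf_ext hμ hμ fun c f => by rw [Category.id_comp]; rfl).symm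

lemma homOf_comp (g : ν.apex ⟶ μ.apex) (h : κ.apex ⟶ ν.apex) :
    homOf μ ν hμ hν g ≫ homOf ν κ hν hκ h = homOf μ κ hμ hκ (h ≫ g) := by
  refine homOf_ext hμ hκ fun c f => ?_
  show (homOf ν κ hν hκ h).hom.app c ((homOf μ ν hμ hν g).hom.app c (μ.hEquiv hμ c f)) = _
  rw [homOf_app, homOf_app, Category.assoc]

lemma homOf_injective : Function.Injective (homOf μ ν hμ hν) := by
  intro g h e
  have h1 : (homOf μ ν hμ hν g).hom.app _ (μ.hEquiv hμ _ (𝟙 _)) =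
    (homOf μ ν hμ hν h).hom.app _ (μ.hEquiv hμ _ (𝟙 _)) := by rw [e]
  rw [homOf_app, homOf_app] at h1
  simpa using (ν.hEquiv hν _).injective h1

/-- The Yoneda argument: by naturality a transformation is determined by its value on the element
that corresponds to the identity of `c_μ`. -/
lemma homOf_surjective : Function.Surjective (homOf μ ν hμ hν) := by
  intro τ
  refine ⟨(ν.hEquiv hν _).symm (τ.hom.app μ.apex (μ.hEquiv hμ _ (𝟙 _))), ?_⟩
  refine (homOf_ext hμ hν fun c f => ?_).symm
  have h1 := congrFun (τ.hom.naturality f) (μ.hEquiv hμ _ (𝟙 _))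
  have h2 : τ.hom.app c (μ.hEquiv hμ c ((μ.hEquiv hμ _).symm (μ.hEquiv hμ _ (𝟙 _)) ≫ f)) =
    ν.hEquiv hν c ((ν.hEquiv hν _).symm (τ.hom.app μ.apex (μ.hEquiv hμ _ (𝟙 _))) ≫ f) := h1
  simpa using h2

/-- The transformation induced by `g` is an inclusion if and only if `μ = ν ∗ g`. -/
lemma isInclusion_homOf_iff (g : ν.apex ⟶ μ.apex) :
    HasInclusions.IsInclusion (homOf μ ν hμ hν g) ↔ ∀ a, μ.comp a = ν.comp a ≫ g := by
  constructor
  · intro h a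
    -- The element corresponding to the identity already encodes the whole cone `μ`.
    have h1 := h μ.apex (μ.hEquiv hμ _ (𝟙 _))
    rw [homOf_app] at h1
    simpa using ((NormalCone.star_epiComp_eq_iff hν hμ _ _).mp h1 a).symm
  · intro h c x
    obtain ⟨f, rfl⟩ := (μ.hEquiv hμ c).surjective x
    rw [homOf_app]
    refine (NormalCone.star_epiComp_eq_iff hν hμ _ _).mpr fun a => ?_
    rw [h a, Category.assoc]

lemma exists_eq_H (X : Dual C) :
    ∃ (μ : NormalCone C) (hμ : IsIdempotentElem μ), X = H μ hμ := by
  obtain ⟨X, μ, hμ, rfl⟩ := X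
  exact ⟨μ, hμ, rfl⟩

instance isCategoryWithSubobjects : IsCategoryWithSubobjects (Dual C) where
  id_mem _ _ _ := rfl
  comp_mem φ ψ hφ hψ c x := (hψ c _).trans (hφ c x)
  thin φ ψ hφ hψ := hom_ext fun c x => Subtype.ext ((hφ c x).trans (hψ c x).symm)
  strict {X Y} φ ψ hφ hψ := by
    obtain ⟨μ, hμ, rfl⟩ := exists_eq_H X
    obtain ⟨ν, hν, rfl⟩ := exists_eq_H Y
    have hobj : ∀ c, μ.hSet c = ν.hSet c := fun c => Set.Subset.antisymm
      (fun x hx =>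
        Eq.mp (congrArg (· ∈ ν.hSet c) (hφ c ⟨x, hx⟩)) (φ.hom.app c ⟨x, hx⟩).2)
      (fun x hx =>
        Eq.mp (congrArg (· ∈ μ.hSet c) (hψ c ⟨x, hx⟩)) (ψ.hom.app c ⟨x, hx⟩).2)
    -- Once the sets agree, the components are identities, and naturality forces the two functors to
    -- agree on morphisms.
    have key : ∀ F G : C ⥤ SubsetCat (NormalCone C), ∀ τ : F ⟶ G,
        (∀ c x, ((τ.app c x : (G.obj c).carrier) : NormalCone C) = x) →
        (∀ c, F.obj c = G.obj c) → F = G := by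
      rintro ⟨o, m, _, _⟩ ⟨o', m', _, _⟩ τ hτ ho
      obtain rfl : o = o' := funext ho
      have hm : @m = @m' := by
        funext c d g
        have h1 := τ.naturality g
        have h2 : ∀ c, τ.app c = 𝟙 _ := fun c => funext fun x => Subtype.ext (hτ c x)
        rw [h2, h2] at h1
        simpa using h1
      subst hm
      rfl
    have h := key _ _ φ.hom hφ (fun c => congrArg SubsetCat.mk (hobj c))
    exact ObjectProperty.FullSubcategory.ext h
  mono φ hφ := ⟨fun g h e => hom_ext fun c x => Subtype.ext <| by
    rw [← hφ, ← hφ]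
    exact congrArg (fun t => ((t.hom.app c x : _) : NormalCone C)) e⟩
  left_mem α ψ h hψ c x := (hψ c _).symm.trans (h c x)

variable {hμ hν}

lemma exists_comp_of_isInclusion {i : H μ hμ ⟶ H ν hν} (hi : HasInclusions.IsInclusion i) :
    ∃ g : ν.apex ⟶ μ.apex, i = homOf μ ν hμ hν g ∧ ∀ a, μ.comp a = ν.comp a ≫ g := by
  obtain ⟨g, rfl⟩ := homOf_surjective hμ hν i
  exact ⟨g, rfl, (isInclusion_homOf_iff hμ hν g).mp hi⟩

/-- Mutual inclusions are an equality, so different cones that are obtained from each other by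
composition define the same object of the dual. -/
lemma H_eq_of_comp (g : ν.apex ⟶ μ.apex) (h : μ.apex ⟶ ν.apex)
    (hg : ∀ a, μ.comp a = ν.comp a ≫ g) (hh : ∀ a, ν.comp a = μ.comp a ≫ h) :
    H μ hμ = H ν hν :=
  IsCategoryWithSubobjects.strict _ _ ((isInclusion_homOf_iff hμ hν g).mpr hg)
    ((isInclusion_homOf_iff hν hμ h).mpr hh)

lemma isInclusion_eqToHom {X Y : Dual C} (e : X = Y) :
    HasInclusions.IsInclusion (eqToHom e) := by
  subst e
  exact IsCategoryWithSubobjects.id_mem X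

/-- The `M`-set does not depend on the representing cone: an equality of `H`-functors is an
inclusion in both directions, so the two cones differ by mutually inverse morphisms of their apices.
-/
lemma mem_MSet_H_iff (c : C) : c ∈ (H μ hμ).MSet ↔ IsIso (μ.comp c) := by
  constructor
  · rintro ⟨ν, hν, e, hc⟩
    obtain ⟨g, -, hg⟩ := exists_comp_of_isInclusion (isInclusion_eqToHom e)
    obtain ⟨h, -, hh⟩ := exists_comp_of_isInclusion (isInclusion_eqToHom e.symm)
    have h1 : g ≫ h = 𝟙 _ := by
      rw [← ν.comp_apex_of_idem hν, hh, hg, ν.comp_apex_of_idem hν, Category.id_comp]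
    have h2 : h ≫ g = 𝟙 _ := by
      rw [← μ.comp_apex_of_idem hμ, hg, hh, μ.comp_apex_of_idem hμ, Category.id_comp]
    have : IsIso g := ⟨h, h1, h2⟩
    rw [hg]
    infer_instance
  · exact fun h => ⟨μ, hμ, rfl, h⟩

lemma exists_inverse_of_isIso (g : ν.apex ⟶ μ.apex) (h : IsIso (homOf μ ν hμ hν g)) :
    ∃ k : μ.apex ⟶ ν.apex, g ≫ k = 𝟙 _ ∧ k ≫ g = 𝟙 _ := by
  obtain ⟨k, hk⟩ := homOf_surjective hν hμ (inv (homOf μ ν hμ hν g))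
  refine ⟨k, homOf_injective hν hν ?_, homOf_injective hμ hμ ?_⟩
  · rw [← homOf_comp hν hμ hν, hk, IsIso.inv_hom_id, homOf_id]
  · rw [← homOf_comp hμ hν hμ, hk, IsIso.hom_inv_id, homOf_id]

lemma isIso_homOf (g : ν.apex ⟶ μ.apex) [IsIso g] : IsIso (homOf μ ν hμ hν g) :=
  ⟨homOf ν μ hν hμ (inv g), by rw [homOf_comp, IsIso.inv_hom_id, homOf_id],
    by rw [homOf_comp, IsIso.hom_inv_id, homOf_id]⟩

/-- If the inclusion is induced by `g`, its left inverses correspond to the sections of `g`. One of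
them is `ν(c_μ)`, since `ν(c_μ) g = μ(c_μ) = 1`, and there is no other by `section_unique`. -/
lemma splits_uniquely {X Y : Dual C} (i : X ⟶ Y) (hi : HasInclusions.IsInclusion i) :
    ∃! θ : Y ⟶ X, i ≫ θ = 𝟙 X := by
  obtain ⟨μ, hμ, rfl⟩ := exists_eq_H X
  obtain ⟨ν, hν, rfl⟩ := exists_eq_H Y
  obtain ⟨g, rfl, hg⟩ := exists_comp_of_isInclusion hi
  refine ⟨homOf ν μ hν hμ (ν.comp μ.apex), ?_, ?_⟩
  · show _ ≫ _ = _
    rw [homOf_comp, ← hg, μ.comp_apex_of_idem hμ, homOf_id]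
  · intro θ hθ
    obtain ⟨h, rfl⟩ := homOf_surjective hν hμ θ
    rw [homOf_comp, ← homOf_id] at hθ
    have h1 := homOf_injective hμ hμ hθ
    refine congrArg _ (section_unique g _ _ h1 ?_)
    rw [← hg, μ.comp_apex_of_idem hμ]

/-- The data in `C` behind a normal factorisation in the dual. -/
lemma exists_of_normalFactorisation {g : ν.apex ⟶ μ.apex}
    (F : NormalFactorisation (homOf μ ν hμ hν g)) :
    ∃ (μ' ν' : NormalCone C) (hμ' : IsIdempotentElem μ') (hν' : IsIdempotentElem ν')
      (i : μ'.apex ⟶ μ.apex) (p : μ.apex ⟶ μ'.apex) (s : ν'.apex ⟶ μ'.apex)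
      (t : μ'.apex ⟶ ν'.apex) (q : ν.apex ⟶ ν'.apex) (j : ν'.apex ⟶ ν.apex),
      F.coim = H μ' hμ' ∧ F.im = H ν' hν' ∧ i ≫ p = 𝟙 _ ∧ s ≫ t = 𝟙 _ ∧ t ≫ s = 𝟙 _ ∧
      j ≫ q = 𝟙 _ ∧ q ≫ s ≫ i = g ∧ (∀ a, μ'.comp a = μ.comp a ≫ p) ∧
      ∀ a, ν'.comp a = ν.comp a ≫ q := by
  obtain ⟨X, Y, θ, σ, ι, ⟨k, hk, hkθ⟩, hσ, hι, hF⟩ := F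
  obtain ⟨μ', hμ', rfl⟩ := exists_eq_H X
  obtain ⟨ν', hν', rfl⟩ := exists_eq_H Y
  obtain ⟨i, rfl⟩ := homOf_surjective _ _ θ
  obtain ⟨s, rfl⟩ := homOf_surjective _ _ σ
  obtain ⟨t, hst, hts⟩ := exists_inverse_of_isIso s hσ
  obtain ⟨p, rfl, hp⟩ := exists_comp_of_isInclusion hk
  obtain ⟨q, rfl, hq⟩ := exists_comp_of_isInclusion hι
  refine ⟨μ', ν', hμ', hν', i, p, s, t, q, ν.comp ν'.apex, rfl, rfl, ?_, hst, hts, ?_, ?_, hp, hq⟩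
  · apply homOf_injective hμ' hμ'
    rw [← hkθ.trans (homOf_id hμ').symm, homOf_comp]
  · rw [← hq, ν'.comp_apex_of_idem hν']
  · apply homOf_injective hμ hν
    rw [← hF, homOf_comp, homOf_comp, Category.assoc]

/-- The morphism `g` of `C` factors as `q s i` in two ways. The two `q` differ by isomorphisms, and
so do the two `i`; the left inverses `p` are then carried to one another by `retraction_unique`.
Hence the cones `μ ∗ p` and `ν ∗ q` define the same objects for both factorisations. -/
lemma normalFactorisation_unique {X Y : Dual C} {φ : X ⟶ Y} (F G : NormalFactorisation φ) :
    F = G := by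
  obtain ⟨μ, hμ, rfl⟩ := exists_eq_H X
  obtain ⟨ν, hν, rfl⟩ := exists_eq_H Y
  obtain ⟨g, rfl⟩ := homOf_surjective _ _ φ
  obtain ⟨μ₁, ν₁, hμ₁, hν₁, i₁, p₁, s₁, t₁, q₁, j₁, hc₁, hm₁, hip₁, hst₁, hts₁, hjq₁, hg₁, hp₁,
    hq₁⟩ := exists_of_normalFactorisation F
  obtain ⟨μ₂, ν₂, hμ₂, hν₂, i₂, p₂, s₂, t₂, q₂, j₂, hc₂, hm₂, hip₂, hst₂, hts₂, hjq₂, hg₂, hp₂,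
    hq₂⟩ := exists_of_normalFactorisation G
  have e₁ : q₁ ≫ s₁ ≫ i₁ ≫ p₂ ≫ t₂ = q₂ := by
    have := hg₁.trans hg₂.symm =≫ (p₂ ≫ t₂)
    simpa [reassoc_of% hip₂, hst₂] using this
  have e₂ : q₂ ≫ s₂ ≫ i₂ ≫ p₁ ≫ t₁ = q₁ := by
    have := hg₂.trans hg₁.symm =≫ (p₁ ≫ t₁)
    simpa [reassoc_of% hip₁, hst₁] using this
  have f₁ : i₁ = (t₁ ≫ j₁ ≫ q₂ ≫ s₂) ≫ i₂ := by
    have := (t₁ ≫ j₁) ≫= hg₁.trans hg₂.symm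
    simpa [reassoc_of% hjq₁, reassoc_of% hts₁] using this
  have f₂ : i₂ = (t₂ ≫ j₂ ≫ q₁ ≫ s₁) ≫ i₁ := by
    have := (t₂ ≫ j₂) ≫= hg₂.trans hg₁.symm
    simpa [reassoc_of% hjq₂, reassoc_of% hts₂] using this
  have k₁ : i₁ ≫ p₂ ≫ i₂ = i₁ := by
    rw [f₁]; simp [reassoc_of% hip₂]
  have k₂ : i₂ ≫ p₁ ≫ i₁ = i₂ := by
    rw [f₂]; simp [reassoc_of% hip₁]
  -- Both sides are left inverses of `i₂`.
  have l₁ : p₁ ≫ i₁ ≫ p₂ = p₂ := retraction_unique i₂ _ _ (by rw [reassoc_of% k₂, hip₂]) hip₂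
  have l₂ : p₂ ≫ i₂ ≫ p₁ = p₁ := retraction_unique i₁ _ _ (by rw [reassoc_of% k₁, hip₁]) hip₁
  refine NormalFactorisation.ext_of_obj_eq splits_uniquely F G ?_ ?_
  · rw [hc₁, hc₂]
    refine H_eq_of_comp (i₂ ≫ p₁) (i₁ ≫ p₂) (fun a => ?_) (fun a => ?_)
    · rw [hp₁, hp₂, Category.assoc, l₂]
    · rw [hp₁, hp₂, Category.assoc, l₁]
  · rw [hm₁, hm₂]
    refine H_eq_of_comp (s₂ ≫ i₂ ≫ p₁ ≫ t₁) (s₁ ≫ i₁ ≫ p₂ ≫ t₂) (fun a => ?_) (fun a => ?_)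
    · rw [hq₁, hq₂, Category.assoc, e₂]
    · rw [hq₁, hq₂, Category.assoc, e₁]

/-- Every subobject `i : d ⟶ c_μ` and retraction `p` onto it yield an idempotent cone `μ ∗ p`. -/
lemma exists_idem_cone (hμ : IsIdempotentElem μ) {d : C} (i : d ⟶ μ.apex) (p : μ.apex ⟶ d)
    (hi : HasInclusions.IsInclusion i) (hip : i ≫ p = 𝟙 d) :
    ∃ ν : NormalCone C, IsIdempotentElem ν ∧ ∃ e : ν.apex = d,
      ∀ a, ν.comp a ≫ eqToHom e = μ.comp a ≫ p := by
  have : Epi p := by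
    have : Epi (i ≫ p) := by rw [hip]; infer_instance
    exact epi_of_epi i p
  refine ⟨μ.star p, NormalCone.idem_of_comp_apex _ ?_, rfl, fun a => Category.comp_id _⟩
  show μ.comp d ≫ p = 𝟙 d
  rw [← μ.inclusion_comp i hi, μ.comp_apex_of_idem hμ, Category.comp_id, hip]

/-- Reads the factorisation `g = θσι` in `C` backwards: `ι` induces the retraction, `θ` the
inclusion, and the intermediate objects come from `μ ∗ r`, with `r` splitting `ι`, and from `ν ∗ θ`.
-/
lemma nonempty_normalFactorisation {X Y : Dual C} (φ : X ⟶ Y) :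
    Nonempty (NormalFactorisation φ) := by
  obtain ⟨μ, hμ, rfl⟩ := exists_eq_H X
  obtain ⟨ν, hν, rfl⟩ := exists_eq_H Y
  obtain ⟨g, rfl⟩ := homOf_surjective _ _ φ
  obtain ⟨c, d, θ, σ, ι, ⟨k, hk, hkθ⟩, hσ, hι, hF⟩ := normalFact g
  obtain ⟨r, hr, -⟩ := IsUnambiguous.splits_uniquely ι hι
  obtain ⟨μ', hμ', rfl, hμ'c⟩ := exists_idem_cone hμ ι r hι hr
  obtain ⟨ν', hν', rfl, hν'c⟩ := exists_idem_cone hν k θ hk hkθ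
  simp only [eqToHom_refl, Category.comp_id] at hμ'c hν'c
  exact ⟨
    { coim := H μ' hμ', im := H ν' hν'
      θ := homOf μ μ' hμ hμ' ι
      σ := homOf μ' ν' hμ' hν' σ
      ι := homOf ν' ν hν' hν θ
      retraction := ⟨homOf μ' μ hμ' hμ r, (isInclusion_homOf_iff _ _ _).mpr hμ'c, by
        rw [homOf_comp, hr, homOf_id]⟩
      iso := isIso_homOf σ
      inclusion := (isInclusion_homOf_iff _ _ _).mpr hν'c
      fac := by rw [homOf_comp, homOf_comp, Category.assoc, hF] }⟩

/-- Compatibility with inclusions of the cone with apex `H(κ;-)` whose component at `H(μ;-)` is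
induced by `μ(c_κ)`. Applied to an identity, it shows that this component does not depend on the
choice of `μ`. -/
lemma comp_homOf_of_isInclusion {X Y : Dual C} (hX : X = H μ hμ) (hY : Y = H ν hν)
    (hκ : IsIdempotentElem κ) (i : X ⟶ Y) (hi : HasInclusions.IsInclusion i) :
    i ≫ eqToHom hY ≫ homOf ν κ hν hκ (ν.comp κ.apex) =
      eqToHom hX ≫ homOf μ κ hμ hκ (μ.comp κ.apex) := by
  subst hX hY
  obtain ⟨g, rfl, hg⟩ := exists_comp_of_isInclusion hi
  simp [homOf_comp, hg]

lemma exists_cone (X : Dual C) :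
    ∃ γ : NormalCone (Dual C), γ.apex = X ∧ γ.comp γ.apex = 𝟙 γ.apex := by
  obtain ⟨κ, hκ, rfl⟩ := exists_eq_H X
  choose m hm he using exists_eq_H (C := C)
  have hid : eqToHom (he (H κ hκ)) ≫ homOf _ κ (hm _) hκ ((m _).comp κ.apex) = 𝟙 (H κ hκ) := by
    rw [← comp_homOf_of_isInclusion (he (H κ hκ)) rfl hκ (𝟙 _)
      (IsCategoryWithSubobjects.id_mem _), eqToHom_refl, Category.id_comp, Category.id_comp,
      κ.comp_apex_of_idem hκ, homOf_id]
  refine ⟨⟨H κ hκ, fun Y => eqToHom (he Y) ≫ homOf _ κ (hm Y) hκ ((m Y).comp κ.apex),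
    fun i hi => comp_homOf_of_isInclusion _ _ hκ i hi, H κ hκ, ?_⟩, rfl, hid⟩
  rw [hid]
  infer_instance

/-- The dual of an unambiguous category is unambiguous. -/
instance isUnambiguous : IsUnambiguous (Dual C) where
  splits_uniquely i hi := splits_uniquely i hi
  unique_factorisation φ := by
    obtain ⟨F⟩ := nonempty_normalFactorisation φ
    exact ⟨⟨⟨F⟩, fun G => normalFactorisation_unique G F⟩⟩
  exists_cone := exists_cone

end Dual

end General

/-! ### Idempotents of locally inverse semigroups -/

section LocallyInverse

variable {S : Type u} [Semigroup S]

lemma IsRegularSemigroup.op (h : IsRegularSemigroup S) : IsRegularSemigroup Sᵐᵒᵖ := by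
  intro a
  obtain ⟨b, h1, h2⟩ := h a.unop
  exact ⟨MulOpposite.op b, unop_injective (by simpa [mul_assoc] using h1),
    unop_injective (by simpa [mul_assoc] using h2)⟩

variable (S) in
/-- Any two idempotents below a common idempotent commute. -/
def LocallyCommute : Prop :=
  ∀ e g h : S, IsIdempotentElem e → IsIdempotentElem g → IsIdempotentElem h →
    e * g = g → g * e = g → e * h = h → h * e = h → g * h = h * g

lemma LocallyCommute.op (h : LocallyCommute S) : LocallyCommute Sᵐᵒᵖ := by
  intro e g k he hg hk h1 h2 h3 h4
  exact unop_injective (h e.unop k.unop g.unop (congrArg unop he) (congrArg unop hk)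
    (congrArg unop hg) (congrArg unop h4) (congrArg unop h3) (congrArg unop h2)
    (congrArg unop h1))

/-- Idempotents of an inverse semigroup commute. -/
lemma IsInverseSemigroup.commute {T : Type u} [Semigroup T] (hT : IsInverseSemigroup T) {g h : T}
    (hg : IsIdempotentElem g) (hh : IsIdempotentElem h) : g * h = h * g := by
  have idem : ∀ {a b : T}, IsIdempotentElem a → IsIdempotentElem b →
      IsIdempotentElem (a * b) := by
    intro a b ha hb
    obtain ⟨x, ⟨h1, h2⟩, hu⟩ := hT (a * b)
    have ha' : ∀ y, a * (a * y) = a * y := fun y => by rw [← mul_assoc, ha.eq]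
    have hb' : ∀ y, b * (b * y) = b * y := fun y => by rw [← mul_assoc, hb.eq]
    simp only [mul_assoc] at h1 h2
    have h2' : ∀ y, x * (a * (b * (x * y))) = x * y := fun y => by
      simpa only [mul_assoc] using congrArg (· * y) h2
    -- The element `b x a` is again an inverse of `a b`, so it equals `x`. This makes `x`
    -- idempotent, hence its own inverse; `a b` is another inverse of `x`, so `a b = x`.
    have h3 : b * x * a = x := by
      refine hu _ ⟨?_, ?_⟩
      · simp only [mul_assoc, ha', hb', h1]
      · simp only [mul_assoc, ha', hb', h2']
    have hx : x * x = x := by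
      conv_lhs => rw [← h3]
      simp only [mul_assoc, h2']
      simpa only [mul_assoc] using h3
    have h4 : a * b = x :=
      (hT x).unique ⟨by simpa only [mul_assoc] using h2, by simpa only [mul_assoc] using h1⟩
        ⟨by rw [hx, hx], by rw [hx, hx]⟩
    rw [h4]
    exact hx
  have h1 := idem hg hh
  have h2 := idem hh hg
  have h1' : g * (h * (g * h)) = g * h := by simpa only [mul_assoc] using h1.eq
  have h2' : h * (g * (h * g)) = h * g := by simpa only [mul_assoc] using h2.eq
  have hg' : ∀ y, g * (g * y) = g * y := fun y => by rw [← mul_assoc, hg.eq]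
  have hh' : ∀ y, h * (h * y) = h * y := fun y => by rw [← mul_assoc, hh.eq]
  -- Both `g h` and `h g` are inverses of the idempotent `g h`.
  refine (hT (g * h)).unique ⟨?_, ?_⟩ ⟨?_, ?_⟩
  · rw [h1.eq, h1.eq]
  · rw [h1.eq, h1.eq]
  · simp only [mul_assoc, hg', hh', h1']
  · simp only [mul_assoc, hg', hh', h2']

lemma IsLocallyInverseSemigroup.locallyCommute (hS : IsLocallyInverseSemigroup S) :
    LocallyCommute S := by
  intro e g h he hg hh h1 h2 h3 h4
  have hm : ∀ x, e * x = x → x * e = x → x ∈ Subsemigroup.corner e :=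
    fun x hx hx' => ⟨x, by show e * x * e = x; rw [hx, hx']⟩
  exact congrArg Subtype.val ((hS.2 e he).commute (g := ⟨g, hm g h1 h2⟩) (h := ⟨h, hm h h3 h4⟩)
    (Subtype.ext hg) (Subtype.ext hh))

lemma mem_sandwich_iff {e f u : S} (he : IsIdempotentElem e) (hf : IsIdempotentElem f) :
    u ∈ sandwich e f ↔ e * u = u ∧ u * f = u := by
  constructor
  · rintro ⟨s, rfl⟩
    exact ⟨by rw [← mul_assoc, ← mul_assoc, he.eq], by rw [mul_assoc, hf.eq]⟩
  · rintro ⟨h1, h2⟩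
    exact ⟨u, by rw [h1, h2]⟩

/-- An element `u` of `eSf` has an inverse in `fSe`. -/
lemma exists_areInverse (hS : IsRegularSemigroup S) {e f u : S} (he : IsIdempotentElem e)
    (hf : IsIdempotentElem f) (h1 : e * u = u) (h2 : u * f = u) :
    ∃ v, u * v * u = u ∧ v * u * v = v ∧ f * v = v ∧ v * e = v := by
  obtain ⟨w, hw1, hw2⟩ := hS u
  have h2' : ∀ y, u * (f * y) = u * y := fun y => by rw [← mul_assoc, h2]
  -- Cutting an arbitrary inverse `w` down by `f` and `e` keeps it an inverse, since `e u = u = u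
  -- f`.
  refine ⟨f * w * e, ?_, ?_, ?_, ?_⟩
  · rw [mul_assoc, mul_assoc, h1, ← mul_assoc, ← mul_assoc, h2, hw1]
  · calc f * w * e * u * (f * w * e) = f * w * (e * u) * f * w * e := by simp only [mul_assoc]
      _ = f * (w * u * w) * e := by simp only [h1, mul_assoc, h2']
      _ = f * w * e := by rw [hw2]
  · rw [← mul_assoc, ← mul_assoc, hf.eq]
  · rw [mul_assoc, he.eq]

end LocallyInverse

/-! ### The category `𝕃(S)` -/

namespace LCat

variable {S : Type u} [Semigroup S]

lemma exists_eq_of (A : LCat S) : ∃ (e : S) (he : IsIdempotentElem e), A = of e he := by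
  obtain ⟨_, e, he, rfl⟩ := A
  exact ⟨e, he, rfl⟩

lemma of_eq_of {e f : S} (he : IsIdempotentElem e) (hf : IsIdempotentElem f) (h1 : e * f = e)
    (h2 : f * e = f) : of e he = of f hf := by
  have h : principalLeft e = principalLeft f := Set.Subset.antisymm
    (by rintro _ ⟨s, rfl⟩; exact ⟨s * e, by rw [mul_assoc, h1]⟩)
    (by rintro _ ⟨s, rfl⟩; exact ⟨s * f, by rw [mul_assoc, h2]⟩)
  simp only [of, h]

lemma mul_eq_of_of_eq {e f : S} {he : IsIdempotentElem e} {hf : IsIdempotentElem f}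
    (h : of e he = of f hf) : e * f = e := by
  have h1 : e ∈ principalLeft f := Eq.mp (congrArg (e ∈ carrier ·) h) ⟨e, he.eq.symm⟩
  obtain ⟨s, rfl⟩ := h1
  rw [mul_assoc, hf.eq]

variable {e f g : S} {he : IsIdempotentElem e} {hf : IsIdempotentElem f}
  {hg : IsIdempotentElem g}

lemma hom_ext {A B : LCat S} {φ ψ : A ⟶ B} (h : ∀ x, (φ.1 x : S) = ψ.1 x) : φ = ψ :=
  Subtype.ext (funext fun x => Subtype.ext (h x))

lemma rho_apply (u : S) (hu : u ∈ sandwich e f) (x : (of e he).carrier) :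
    ((rho he hf u hu).1 x : S) = x * u := rfl

lemma exists_eq_rho (φ : of e he ⟶ of f hf) :
    ∃ (u : S) (hu : u ∈ sandwich e f), φ = rho he hf u hu := by
  obtain ⟨e', u, f', -, -, -, -, -, hφ⟩ := φ.2
  obtain ⟨s, hs⟩ := (φ.1 ⟨e, e, he.eq.symm⟩).2
  rw [hφ] at hs
  -- The given `u` refers to possibly different generators of the two ideals; multiplying by `e`
  -- moves it into `eSf` without changing the map on `Se`.
  refine ⟨e * u, (mem_sandwich_iff he hf).mpr ⟨by rw [← mul_assoc, he.eq], ?_⟩, hom_ext ?_⟩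
  · change e * u = s * f at hs
    rw [hs, mul_assoc, hf.eq]
  · rintro ⟨x, s, rfl⟩
    rw [rho_apply, hφ]
    simp only [← mul_assoc, mul_assoc s e e, he.eq]

lemma rho_inj {u v : S} {hu : u ∈ sandwich e f} {hv : v ∈ sandwich e f} :
    rho he hf u hu = rho he hf v hv ↔ u = v := by
  constructor
  · intro h
    have h1 : e * u = e * v :=
      congrArg (fun φ : of e he ⟶ of f hf => (φ.1 ⟨e, e, he.eq.symm⟩ : S)) h
    rwa [((mem_sandwich_iff he hf).mp hu).1, ((mem_sandwich_iff he hf).mp hv).1] at h1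
  · rintro rfl
    rfl

lemma mul_mem_sandwich {u v : S} (hu : u ∈ sandwich e f) (hv : v ∈ sandwich f g) :
    u * v ∈ sandwich e g := by
  obtain ⟨s, rfl⟩ := hu
  obtain ⟨t, rfl⟩ := hv
  exact ⟨s * f * (f * t), by simp only [mul_assoc]⟩

lemma rho_comp {u v : S} (hu : u ∈ sandwich e f) (hv : v ∈ sandwich f g) :
    rho he hf u hu ≫ rho hf hg v hv = rho he hg (u * v) (mul_mem_sandwich hu hv) :=
  hom_ext fun x => mul_assoc (x : S) u v

lemma self_mem_sandwich (he : IsIdempotentElem e) : e ∈ sandwich e e :=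
  ⟨e, by rw [he.eq, he.eq]⟩

lemma id_eq_rho (he : IsIdempotentElem e) :
    𝟙 (of e he) = rho he he e (self_mem_sandwich he) := by
  refine hom_ext ?_
  rintro ⟨x, s, rfl⟩
  show s * e = s * e * e
  rw [mul_assoc, he.eq]

lemma rho_comp_eq_id_iff {u v : S} {hu : u ∈ sandwich e f} {hv : v ∈ sandwich f e} :
    rho he hf u hu ≫ rho hf he v hv = 𝟙 _ ↔ u * v = e := by
  rw [rho_comp, id_eq_rho, rho_inj]

lemma isIso_rho_iff {u : S} {hu : u ∈ sandwich e f} :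
    IsIso (rho he hf u hu) ↔ ∃ v ∈ sandwich f e, u * v = e ∧ v * u = f := by
  constructor
  · rintro ⟨φ, h1, h2⟩
    obtain ⟨v, hv, rfl⟩ := exists_eq_rho φ
    exact ⟨v, hv, rho_comp_eq_id_iff.mp h1, rho_comp_eq_id_iff.mp h2⟩
  · rintro ⟨v, hv, h1, h2⟩
    exact ⟨rho hf he v hv, rho_comp_eq_id_iff.mpr h1, rho_comp_eq_id_iff.mpr h2⟩

lemma isInclusion_rho_iff {u : S} {hu : u ∈ sandwich e f} :
    HasInclusions.IsInclusion (rho he hf u hu) ↔ u = e := by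
  constructor
  · intro h
    have h1 : e * u = e := h ⟨e, e, he.eq.symm⟩
    rwa [((mem_sandwich_iff he hf).mp hu).1] at h1
  · rintro rfl ⟨x, s, rfl⟩
    show s * u * u = s * u
    rw [mul_assoc, he.eq]

instance isCategoryWithSubobjects : IsCategoryWithSubobjects (LCat S) where
  id_mem _ _ := rfl
  comp_mem φ ψ hφ hψ x := (hψ _).trans (hφ x)
  thin φ ψ hφ hψ := hom_ext fun x => (hφ x).trans (hψ x).symm
  strict {A B} φ ψ hφ hψ := by
    have h : A.carrier = B.carrier := Set.Subset.antisymm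
      (fun x hx => Eq.mp (congrArg (· ∈ B.carrier) (hφ ⟨x, hx⟩)) (φ.1 ⟨x, hx⟩).2)
      (fun x hx => Eq.mp (congrArg (· ∈ A.carrier) (hψ ⟨x, hx⟩)) (ψ.1 ⟨x, hx⟩).2)
    cases A
    cases B
    cases h
    rfl
  mono φ hφ := ⟨fun g h e => hom_ext fun x => by
    rw [← hφ, ← hφ]
    exact congrArg (fun t => ((t.1 x : _) : S)) e⟩
  left_mem α ψ h hψ x := (hψ _).symm.trans (h x)

/-- A left inverse of the inclusion `Se ⊆ Sf` is translation by some `v ∈ fSe` with `ev = e`. Both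
`v` and `fe` are idempotents below `f`, so they commute, and this gives `v = fe`. -/
lemma splits_uniquely (hc : LocallyCommute S) {A B : LCat S} (i : A ⟶ B)
    (hi : HasInclusions.IsInclusion i) : ∃! θ : B ⟶ A, i ≫ θ = 𝟙 A := by
  obtain ⟨e, he, rfl⟩ := exists_eq_of A
  obtain ⟨f, hf, rfl⟩ := exists_eq_of B
  obtain ⟨u, hu, rfl⟩ := exists_eq_rho i
  obtain rfl := isInclusion_rho_iff.mp hi
  have hef := ((mem_sandwich_iff he hf).mp hu).2
  have key : ∀ v, f * v = v → v * u = v → u * v = u → v = f * u := by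
    intro v h1 h2 h3
    have hfu : IsIdempotentElem (f * u) := by
      show f * u * (f * u) = f * u
      rw [mul_assoc, ← mul_assoc u, hef, he.eq]
    have hv : IsIdempotentElem v := by
      show v * v = v
      calc v * v = v * u * v := by rw [h2]
        _ = v := by rw [mul_assoc, h3, h2]
    have h4 := hc f v (f * u) hf hv hfu h1 (by rw [← h2, mul_assoc, hef])
      (by rw [← mul_assoc, hf.eq]) (by rw [mul_assoc, hef])
    have h5 : v * f = v := by rw [← h2, mul_assoc, hef]
    rwa [← mul_assoc, h5, h2, mul_assoc, h3] at h4
  refine ⟨rho hf he (f * u) ⟨u, by rw [mul_assoc, he.eq]⟩, ?_, ?_⟩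
  · exact rho_comp_eq_id_iff.mpr (by rw [← mul_assoc, hef, he.eq])
  · intro θ hθ
    obtain ⟨v, hv, rfl⟩ := exists_eq_rho θ
    obtain ⟨h1, h2⟩ := (mem_sandwich_iff hf he).mp hv
    exact rho_inj.mpr (key v h1 h2 (rho_comp_eq_id_iff.mp hθ))

lemma nonempty_normalFactorisation (hS : IsRegularSemigroup S) {A B : LCat S} (φ : A ⟶ B) :
    Nonempty (NormalFactorisation φ) := by
  obtain ⟨e, he, rfl⟩ := exists_eq_of A
  obtain ⟨f, hf, rfl⟩ := exists_eq_of B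
  obtain ⟨u, hu, rfl⟩ := exists_eq_rho φ
  obtain ⟨h1, h2⟩ := (mem_sandwich_iff he hf).mp hu
  -- With `v` in `fSe`, the idempotent `uv` lies below `e` and `vu` below `f`; `u` and `v` are
  -- mutually inverse translations between `S(uv)` and `S(vu)`.
  obtain ⟨v, huvu, hvuv, h3, h4⟩ := exists_areInverse hS he hf h1 h2
  have hh : IsIdempotentElem (u * v) := by
    show u * v * (u * v) = u * v
    rw [← mul_assoc, huvu]
  have hg : IsIdempotentElem (v * u) := by
    show v * u * (v * u) = v * u
    rw [← mul_assoc, hvuv]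
  have m1 : u * v ∈ sandwich e (u * v) :=
    (mem_sandwich_iff he hh).mpr ⟨by rw [← mul_assoc, h1], hh.eq⟩
  have m2 : u * v ∈ sandwich (u * v) e :=
    (mem_sandwich_iff hh he).mpr ⟨hh.eq, by rw [mul_assoc, h4]⟩
  have m3 : u ∈ sandwich (u * v) (v * u) :=
    (mem_sandwich_iff hh hg).mpr ⟨huvu, by rw [← mul_assoc, huvu]⟩
  have m4 : v ∈ sandwich (v * u) (u * v) :=
    (mem_sandwich_iff hg hh).mpr ⟨hvuv, by rw [← mul_assoc, hvuv]⟩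
  have m5 : v * u ∈ sandwich (v * u) f :=
    (mem_sandwich_iff hg hf).mpr ⟨hg.eq, by rw [mul_assoc, h2]⟩
  exact ⟨
    { coim := of (u * v) hh, im := of (v * u) hg
      θ := rho he hh (u * v) m1
      σ := rho hh hg u m3
      ι := rho hg hf (v * u) m5
      retraction := ⟨rho hh he (u * v) m2, isInclusion_rho_iff.mpr rfl,
        rho_comp_eq_id_iff.mpr hh.eq⟩
      iso := isIso_rho_iff.mpr ⟨v, m4, rfl, rfl⟩
      inclusion := isInclusion_rho_iff.mpr rfl
      fac := by
        rw [rho_comp, rho_comp, rho_inj, ← mul_assoc u v u, huvu, huvu] }⟩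

/-- Elementwise description of the objects of a normal factorisation in `𝕃(S)`. -/
lemma exists_of_normalFactorisation {u : S} {hu : u ∈ sandwich e f}
    (F : NormalFactorisation (rho he hf u hu)) :
    ∃ (v g t t' : S) (hv : IsIdempotentElem v) (hg : IsIdempotentElem g),
      F.coim = of v hv ∧ F.im = of g hg ∧ e * v = v ∧ v * e = v ∧ v * u = u ∧ u * t = v ∧
      u * g = u ∧ t' * u = g := by
  obtain ⟨X, Y, θ, σ, ι, ⟨k, hk, hkθ⟩, hσ, hι, hF⟩ := F
  obtain ⟨h, hh, rfl⟩ := exists_eq_of X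
  obtain ⟨g, hg, rfl⟩ := exists_eq_of Y
  obtain ⟨v, hv, rfl⟩ := exists_eq_rho θ
  obtain ⟨s, hs, rfl⟩ := exists_eq_rho σ
  obtain ⟨w, hw, rfl⟩ := exists_eq_rho ι
  obtain ⟨z, hz, rfl⟩ := exists_eq_rho k
  obtain ⟨t, ht, hst, hts⟩ := isIso_rho_iff.mp hσ
  obtain rfl := isInclusion_rho_iff.mp hι
  obtain rfl := isInclusion_rho_iff.mp hk
  rw [rho_comp, rho_comp, rho_inj] at hF
  rw [rho_comp_eq_id_iff] at hkθ
  obtain ⟨v1, v2⟩ := (mem_sandwich_iff he hh).mp hv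
  obtain ⟨s1, s2⟩ := (mem_sandwich_iff hh hg).mp hs
  obtain ⟨t1, t2⟩ := (mem_sandwich_iff hg hh).mp ht
  obtain ⟨-, z2⟩ := (mem_sandwich_iff hh he).mp hz
  have hv' : IsIdempotentElem v := by
    show v * v = v
    calc v * v = v * z * v := by rw [v2]
      _ = v := by rw [mul_assoc, hkθ, v2]
  rw [s2] at hF
  have hvs : z * u = s := by rw [← hF, ← mul_assoc, hkθ, s1]
  -- The generator `h` of the coimage need not satisfy `eh = h`; the value `v` of the retraction
  -- generates the same left ideal and does lie below `e`.
  refine ⟨v, w, t, t, hv', hg, of_eq_of hh hv' hkθ v2, rfl, v1, ?_, ?_, ?_, ?_, ?_⟩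
  · calc v * e = v * (z * e) := by rw [← mul_assoc, v2]
      _ = v := by rw [z2, v2]
  · rw [← hF, ← mul_assoc, hv'.eq]
  · rw [← hF, mul_assoc, hst, v2]
  · rw [← hF, mul_assoc, s2]
  · rw [← t2, mul_assoc, hvs, hts]

/-- The generators `v`, `v'` of the coimages are R-related to `u` and lie below `e`, so they commute
and are equal. The generators of the images are L-related to `u`, so they generate the same left
ideal. -/
lemma normalFactorisation_unique (hc : LocallyCommute S) {A B : LCat S} {φ : A ⟶ B}
    (F G : NormalFactorisation φ) : F = G := by
  obtain ⟨e, he, rfl⟩ := exists_eq_of A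
  obtain ⟨f, hf, rfl⟩ := exists_eq_of B
  obtain ⟨u, hu, rfl⟩ := exists_eq_rho φ
  obtain ⟨v, g, t, s, hv, hg, hF, hF', a1, a2, a3, a4, a5, a6⟩ := exists_of_normalFactorisation F
  obtain ⟨v', g', t', s', hv', hg', hG, hG', b1, b2, b3, b4, b5, b6⟩ :=
    exists_of_normalFactorisation G
  refine NormalFactorisation.ext_of_obj_eq (splits_uniquely hc) F G ?_ ?_
  · have h1 : v * v' = v' := by rw [← b4, ← mul_assoc, a3]
    have h2 : v' * v = v := by rw [← a4, ← mul_assoc, b3]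
    rw [hF, hG]
    have h3 := hc e v v' he hv hv' a1 a2 b1 b2
    exact of_eq_of _ _ (h3.trans h2) (h3.symm.trans h1)
  · rw [hF', hG']
    exact of_eq_of _ _ (by rw [← a6, mul_assoc, b5]) (by rw [← b6, mul_assoc, a5])

/-- `𝕃(S)` is unambiguous for a locally inverse semigroup `S`. -/
lemma isUnambiguous (hS : IsRegularSemigroup S) (hc : LocallyCommute S) :
    IsUnambiguous (LCat S) where
  splits_uniquely i hi := splits_uniquely hc i hi
  unique_factorisation φ := by
    obtain ⟨F⟩ := nonempty_normalFactorisation hS φ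
    exact ⟨⟨⟨F⟩, fun G => normalFactorisation_unique hc G F⟩⟩
  exists_cone A := by
    obtain ⟨e, he, rfl⟩ := exists_eq_of A
    refine ⟨rhoCone e he, rfl, hom_ext ?_⟩
    rintro ⟨x, s, rfl⟩
    show s * e * e = s * e
    rw [mul_assoc, he.eq]

end LCat

noncomputable section

/-! ### Restrictions to ideals -/

/-- A fully faithful functor which is bijective on objects is an isomorphism of categories. -/
lemma isCatIso_of_bijective {A B : Type u} [SmallCategory A] [SmallCategory B] (F : A ⥤ B)
    [F.Full] [F.Faithful] (h : Function.Bijective F.obj) : IsCatIso F := by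
  obtain ⟨r, hl, hr⟩ := Function.bijective_iff_has_inverse.mp h
  have e : ∀ b, F.obj (r b) = b := hr
  let G : B ⥤ A :=
    { obj := r
      map := fun {b c} φ => F.preimage (eqToHom (e b) ≫ φ ≫ eqToHom (e c).symm)
      map_id := fun b => F.map_injective (by simp)
      map_comp := fun φ ψ => F.map_injective (by simp) }
  refine ⟨G, CategoryTheory.Functor.ext hl fun a b φ => F.map_injective ?_,
    CategoryTheory.Functor.ext hr fun a b φ => ?_⟩
  · simp [G, eqToHom_map]
  · simp [G]

section

variable {C D : Type u} [SmallCategory C] [HasInclusions C] [SmallCategory D] [HasInclusions D]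

lemma isCatIso_restrictIdeal (F : C ⥤ D) (hF : PreservesInclusions F) [F.Full] [F.Faithful]
    (c : C)
    (hinj : ∀ a b : C, IsSubobject a c → IsSubobject b c → F.obj a = F.obj b → a = b)
    (hsurj : ∀ d : D, IsSubobject d (F.obj c) → ∃ a : C, IsSubobject a c ∧ F.obj a = d) :
    IsCatIso (restrictIdeal F hF c) := by
  have h1 : (restrictIdeal F hF c).Full := by
    unfold restrictIdeal
    infer_instance
  have h2 : (restrictIdeal F hF c).Faithful := by
    unfold restrictIdeal
    infer_instance
  apply isCatIso_of_bijective
  constructor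
  · intro a b h
    exact ObjectProperty.FullSubcategory.ext
      (hinj _ _ a.property b.property (congrArg ObjectProperty.FullSubcategory.obj h))
  · intro d
    obtain ⟨a, ha, h⟩ := hsurj d.obj d.property
    exact ⟨⟨a, ha⟩, ObjectProperty.FullSubcategory.ext h⟩

end

/-! ### Generators and values -/

namespace LCat

variable {T : Type u} [Semigroup T]

/-- A chosen idempotent generator of an object of `𝕃(T)`. -/
def gen (A : LCat T) : T := A.exists_generator.choose

lemma gen_idem (A : LCat T) : IsIdempotentElem A.gen := A.exists_generator.choose_spec.1

lemma carrier_eq (A : LCat T) : A.carrier = principalLeft A.gen :=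
  A.exists_generator.choose_spec.2

lemma gen_mem (A : LCat T) : A.gen ∈ A.carrier := by
  rw [carrier_eq A]
  exact ⟨A.gen, A.gen_idem.eq.symm⟩

lemma mul_gen (A : LCat T) {x : T} (hx : x ∈ A.carrier) : x * A.gen = x := by
  rw [carrier_eq A] at hx
  obtain ⟨s, rfl⟩ := hx
  rw [mul_assoc, A.gen_idem.eq]

lemma of_gen (A : LCat T) : of A.gen A.gen_idem = A := by
  have h := A.carrier_eq
  generalize_proofs hA
  generalize A.gen = g at *
  obtain ⟨_, _⟩ := A
  cases h
  rfl

/-- The value of a morphism at the chosen generator of its domain. -/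
def value {A B : LCat T} (φ : A ⟶ B) : T := φ.1 ⟨A.gen, A.gen_mem⟩

lemma apply_eq_mul_value {A B : LCat T} (φ : A ⟶ B) (x : A.carrier) :
    (φ.1 x : T) = x * value φ := by
  obtain ⟨_, u, _, -, -, -, -, -, hφ⟩ := φ.2
  rw [value, hφ, hφ, ← mul_assoc, mul_gen A x.2]

lemma value_mem {A B : LCat T} (φ : A ⟶ B) : value φ ∈ sandwich A.gen B.gen :=
  (mem_sandwich_iff A.gen_idem B.gen_idem).mpr
    ⟨(apply_eq_mul_value φ ⟨A.gen, A.gen_mem⟩).symm, mul_gen B (φ.1 _).2⟩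

/-- Every morphism is right translation by its value at the chosen generator, so values multiply.
This is what makes `toDual` functorial. -/
lemma value_comp {A B D : LCat T} (φ : A ⟶ B) (ψ : B ⟶ D) :
    value (φ ≫ ψ) = value φ * value ψ :=
  apply_eq_mul_value ψ _

lemma value_injective {A B : LCat T} {φ ψ : A ⟶ B} (h : value φ = value ψ) : φ = ψ :=
  hom_ext fun x => by rw [apply_eq_mul_value, apply_eq_mul_value, h]

lemma exists_value_eq {A B : LCat T} {u : T} (hu : u ∈ sandwich A.gen B.gen) :
    ∃ φ : A ⟶ B, value φ = u := by
  obtain ⟨h1, h2⟩ := (mem_sandwich_iff A.gen_idem B.gen_idem).mp hu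
  refine ⟨⟨fun x => ⟨x.1 * u, ?_⟩, A.gen, u, B.gen, A.gen_idem, B.gen_idem, A.carrier_eq,
    B.carrier_eq, hu, fun _ => rfl⟩, h1⟩
  rw [B.carrier_eq]
  exact ⟨x.1 * u, by rw [mul_assoc, h2]⟩

lemma value_of_isInclusion {A B : LCat T} (i : A ⟶ B) (hi : HasInclusions.IsInclusion i) :
    value i = A.gen := hi _

lemma gen_mul_gen_of_isSubobject {A B : LCat T} (h : IsSubobject A B) :
    A.gen * B.gen = A.gen := by
  obtain ⟨i, hi⟩ := h
  rw [← value_of_isInclusion i hi]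
  exact ((mem_sandwich_iff A.gen_idem B.gen_idem).mp (value_mem i)).2

lemma isSubobject_of_mul_gen {A : LCat T} {e : T} (he : IsIdempotentElem e)
    (h : e * A.gen = e) : IsSubobject (of e he) A := by
  rw [← of_gen A]
  exact ⟨rho he _ e ((mem_sandwich_iff he A.gen_idem).mpr ⟨he.eq, h⟩), isInclusion_rho_iff.mpr rfl⟩

lemma gen_of_mul {e : T} (he : IsIdempotentElem e) : (of e he).gen * e = (of e he).gen :=
  mul_eq_of_of_eq (he := gen_idem _) (hf := he) (of_gen _)

lemma mul_gen_of {e : T} (he : IsIdempotentElem e) : e * (of e he).gen = e :=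
  mul_gen (of e he) ⟨e, he.eq.symm⟩

lemma value_rho {e f u : T} (he : IsIdempotentElem e) (hf : IsIdempotentElem f)
    (hu : u ∈ sandwich e f) : value (rho he hf u hu) = (of e he).gen * u := rfl

/-! ### The functor `𝕃(T) ⥤ 𝕃(S)*` of an anti-isomorphism `T ≃ S` -/

variable {S : Type u} [Semigroup S]

/-- `α` reverses products. -/
def IsAnti {T S : Type u} [Semigroup T] [Semigroup S] (α : T ≃ S) : Prop :=
  ∀ x y, α (x * y) = α y * α x

variable {α : T ≃ S}

lemma IsAnti.idem (hα : IsAnti α) {e : T} (he : IsIdempotentElem e) : IsIdempotentElem (α e) :=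
  (hα e e).symm.trans (congrArg α he)

lemma IsAnti.mem_sandwich (hα : IsAnti α) {e f u : T} (hu : u ∈ sandwich e f) :
    α u ∈ sandwich (α f) (α e) := by
  obtain ⟨s, rfl⟩ := hu
  exact ⟨α s, by rw [hα, hα, mul_assoc]⟩

lemma IsAnti.exists_of_mem_sandwich (hα : IsAnti α) {e f : T} {v : S} (hv : v ∈ sandwich (α f) (α e)) : ∃ u ∈ sandwich e f, α u = v := by
  obtain ⟨s, rfl⟩ := hv
  refine ⟨e * (α.symm s * f), ⟨α.symm s, (mul_assoc _ _ _).symm⟩, ?_⟩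
  rw [hα, hα, Equiv.apply_symm_apply]

variable [IsUnambiguous (LCat S)] (hα : IsAnti α)

/-- The functor `H(ρ^{α(e)}; -)`. -/
def dualObj (e : T) (he : IsIdempotentElem e) : Dual (LCat S) :=
  Dual.H (rhoCone (α e) (hα.idem he)) (rhoCone_idem _ _)

variable {e f g : T} {he : IsIdempotentElem e} {hf : IsIdempotentElem f}
  {hg : IsIdempotentElem g}

/-- The natural transformation induced by `ρ(α(f), α(u), α(e))`. -/
def dualMap (he : IsIdempotentElem e) (hf : IsIdempotentElem f) (u : T)
    (hu : u ∈ sandwich e f) : dualObj hα e he ⟶ dualObj hα f hf :=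
  Dual.homOf _ _ _ _ (rho (hα.idem hf) (hα.idem he) (α u) (hα.mem_sandwich hu))

lemma dualMap_congr {u v : T} {hu : u ∈ sandwich e f} (h : u = v) :
    dualMap hα he hf u hu = dualMap hα he hf v (h ▸ hu) := by
  subst h
  rfl

lemma dualMap_comp {u v : T} (hu : u ∈ sandwich e f) (hv : v ∈ sandwich f g) :
    dualMap hα he hf u hu ≫ dualMap hα hf hg v hv =
      dualMap hα he hg (u * v) (mul_mem_sandwich hu hv) :=
  (Dual.homOf_comp _ _ _ _ _).trans
    (congrArg _ ((rho_comp _ _).trans (rho_inj.mpr (hα u v).symm)))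

lemma dualMap_id (he : IsIdempotentElem e) :
    dualMap hα he he e (self_mem_sandwich he) = 𝟙 _ :=
  (congrArg _ (id_eq_rho (hα.idem he)).symm).trans (Dual.homOf_id _)

lemma dualMap_inj {u v : T} {hu : u ∈ sandwich e f} {hv : v ∈ sandwich e f}
    (h : dualMap hα he hf u hu = dualMap hα he hf v hv) : u = v :=
  α.injective (rho_inj.mp (Dual.homOf_injective _ _ h))

lemma exists_eq_dualMap (τ : dualObj hα e he ⟶ dualObj hα f hf) :
    ∃ (u : T) (hu : u ∈ sandwich e f), τ = dualMap hα he hf u hu := by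
  obtain ⟨φ, rfl⟩ := Dual.homOf_surjective _ _ τ
  obtain ⟨v, hv, hφ⟩ := exists_eq_rho (he := hα.idem hf) (hf := hα.idem he) φ
  obtain ⟨u, hu, rfl⟩ := hα.exists_of_mem_sandwich hv
  exact ⟨u, hu, congrArg _ hφ⟩

/-- From `ef = e` follows `α(f) α(e) = α(e)`, so `ρ^{α(e)}` is `ρ^{α(f)}` followed by translation by
`α(e)`. -/
lemma isInclusion_dualMap_self (he : IsIdempotentElem e) (hf : IsIdempotentElem f)
    (hu : e ∈ sandwich e f) : HasInclusions.IsInclusion (dualMap hα he hf e hu) := by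
  refine (Dual.isInclusion_homOf_iff _ _ _).mpr fun a => hom_ext fun x => ?_
  show (x : S) * α e = x * α f * α e
  rw [mul_assoc, ← hα, ((mem_sandwich_iff he hf).mp hu).2]

/-- The inclusion only says that two translations agree. Evaluating at the generator `α(g)`, a left
identity for `α(e)` and `α(f)`, turns this into an equality of elements. The common bound `g` is why
injectivity of `toDual` on objects is obtained inside a principal ideal. -/
lemma eq_of_isInclusion_dualMap {u : T} {hu : u ∈ sandwich e f} (h1 : e * g = e)
    (h2 : f * g = f) (hg : IsIdempotentElem g)
    (h : HasInclusions.IsInclusion (dualMap hα he hf u hu)) : u = e := by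
  have h3 := (Dual.isInclusion_homOf_iff _ _ _).mp h (of (α g) (hα.idem hg))
  have h4 : α g * α e = α g * α f * α u :=
    congrArg (fun φ : of (α g) (hα.idem hg) ⟶ of (α e) (hα.idem he) =>
      (φ.1 ⟨α g, α g, (hα.idem hg).eq.symm⟩ : S)) h3
  rw [← hα, ← hα, ← hα, h1, h2, ((mem_sandwich_iff he hf).mp hu).2] at h4
  exact (α.injective h4).symm

lemma dualObj_eq (he : IsIdempotentElem e) (hf : IsIdempotentElem f) (h1 : e * f = e)
    (h2 : f * e = f) : dualObj hα e he = dualObj hα f hf :=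
  IsCategoryWithSubobjects.strict _ _
    (isInclusion_dualMap_self hα he hf ((mem_sandwich_iff he hf).mpr ⟨he.eq, h1⟩))
    (isInclusion_dualMap_self hα hf he ((mem_sandwich_iff hf he).mpr ⟨hf.eq, h2⟩))

/-- Transport along an equality of objects is an inclusion, and inclusions between given objects are
unique. This turns every `eqToHom` into a translation that can be multiplied out. -/
lemma eqToHom_eq_dualMap (h : dualObj hα e he = dualObj hα f hf) (hu : e ∈ sandwich e f) :
    eqToHom h = dualMap hα he hf e hu :=
  IsCategoryWithSubobjects.thin _ _ (Dual.isInclusion_eqToHom h)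
    (isInclusion_dualMap_self hα he hf hu)

/-- Every subobject of `H(ρ^{α(f)}; -)` is of the form `H(ρ^{α(e)}; -)` with `e ∈ Tf`. -/
lemma exists_of_isSubobject_dualObj {X : Dual (LCat S)} (hX : IsSubobject X (dualObj hα f hf)) :
    ∃ (e : T) (he : IsIdempotentElem e), e * f = e ∧ dualObj hα e he = X := by
  obtain ⟨i, hi⟩ := hX
  obtain ⟨μ, hμ, rfl⟩ := Dual.exists_eq_H X
  obtain ⟨φ, -, hφ⟩ := Dual.exists_comp_of_isInclusion (hν := rhoCone_idem _ _) hi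
  have hid := μ.comp_apex_of_idem hμ
  obtain ⟨A, c, hc, hc'⟩ := μ
  dsimp only at φ hφ hid
  obtain ⟨k, hk, rfl⟩ := exists_eq_of A
  obtain ⟨v, hv, rfl⟩ := exists_eq_rho (he := hα.idem hf) (hf := hk) φ
  obtain ⟨v1, v2⟩ := (mem_sandwich_iff (hα.idem hf) hk).mp hv
  have hcv : ∀ a (x : a.carrier), ((c a).1 x : S) = x * v := by
    intro a x
    have h1 : ((c a).1 x : S) = x * α f * v := congrArg (fun t => (t.1 x : S)) (hφ a)
    rw [h1, mul_assoc, v1]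
  -- The cone is right multiplication by `v`, and its component at its own apex `Sk` is the
  -- identity. Together with `vk = v` this makes `v` an idempotent generator of `Sk`, whose preimage
  -- under `α` is the required `e`.
  have hkv : k * v = k := by
    rw [← hcv (of k hk) ⟨k, k, hk.eq.symm⟩, hid]
    rfl
  have hvv : IsIdempotentElem v := by
    show v * v = v
    calc v * v = v * k * v := by rw [v2]
      _ = v := by rw [mul_assoc, hkv, v2]
  obtain ⟨e, rfl⟩ := α.surjective v
  have he : IsIdempotentElem e := α.injective ((hα e e).trans hvv)
  refine ⟨e, he, α.injective ((hα e f).trans v1), ?_⟩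
  refine Dual.H_eq_of_comp
    (rho hk (hα.idem he) k ((mem_sandwich_iff hk (hα.idem he)).mpr ⟨hk.eq, hkv⟩))
    (rho (hα.idem he) hk (α e) ((mem_sandwich_iff (hα.idem he) hk).mpr ⟨hvv, v2⟩))
    (fun a => hom_ext fun x => ?_) (fun a => hom_ext fun x => ?_)
  · show (x : S) * α e = (c a).1 x * k
    rw [hcv, mul_assoc, v2]
  · show ((c a).1 x : S) = x * α e * α e
    rw [hcv, mul_assoc, hvv.eq]

/-- The functor `𝕃(T) ⥤ 𝕃(S)*` given by `Te ↦ H(ρ^{α(e)}; -)`. -/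
def toDual : LCat T ⥤ Dual (LCat S) where
  obj A := dualObj hα A.gen A.gen_idem
  map {A B} φ := dualMap hα A.gen_idem B.gen_idem (value φ) (value_mem φ)
  map_id A := dualMap_id hα A.gen_idem
  map_comp φ ψ := (dualMap_congr hα (value_comp φ ψ)).trans (dualMap_comp hα _ _).symm

lemma toDual_obj_of (he : IsIdempotentElem e) :
    (toDual hα).obj (of e he) = dualObj hα e he :=
  dualObj_eq hα (gen_idem _) he (gen_of_mul he) (mul_gen_of he)

lemma toDual_map_rho (he : IsIdempotentElem e) (hf : IsIdempotentElem f) (u : T)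
    (hu : u ∈ sandwich e f) :
    (toDual hα).map (rho he hf u hu) = eqToHom (toDual_obj_of hα he) ≫
      dualMap hα he hf u hu ≫ eqToHom (toDual_obj_of hα hf).symm := by
  have h1 := eqToHom_eq_dualMap (he := gen_idem _) hα (toDual_obj_of hα he)
    ((mem_sandwich_iff (gen_idem _) he).mpr ⟨(gen_idem _).eq, gen_of_mul he⟩)
  have h2 := eqToHom_eq_dualMap (hf := gen_idem _) hα (toDual_obj_of hα hf).symm
    ((mem_sandwich_iff hf (gen_idem _)).mpr ⟨hf.eq, mul_gen_of hf⟩)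
  refine Eq.trans ?_ (congrArg₂ (fun σ τ => σ ≫ dualMap hα he hf u hu ≫ τ) h1 h2).symm
  refine Eq.trans ?_ (congrArg _ (dualMap_comp hα _ _).symm)
  refine Eq.trans ?_ (dualMap_comp hα _ _).symm
  refine dualMap_congr (hu := value_mem _) hα ?_
  rw [value_rho, ((mem_sandwich_iff he hf).mp hu).2]

lemma toDual_isLocalIsomorphism [IsUnambiguous (LCat T)] : IsLocalIsomorphism (toDual hα) := by
  have hfull : (toDual hα).Full := ⟨fun {A B} τ => by
    obtain ⟨u, hu, rfl⟩ := exists_eq_dualMap (he := A.gen_idem) (hf := B.gen_idem) hα τ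
    obtain ⟨φ, rfl⟩ := exists_value_eq hu
    exact ⟨φ, rfl⟩⟩
  have hfaith : (toDual hα).Faithful :=
    ⟨fun {A B} φ ψ h => value_injective
      (dualMap_inj hα (he := A.gen_idem) (hf := B.gen_idem) (hu := value_mem φ)
        (hv := value_mem ψ) h)⟩
  have hinc : PreservesInclusions (toDual hα) := by
    intro A B i hi
    have h := value_of_isInclusion i hi
    have : (toDual hα).map i = dualMap hα A.gen_idem B.gen_idem A.gen (h ▸ value_mem i) :=
      dualMap_congr (hu := value_mem _) hα h
    rw [this]
    exact isInclusion_dualMap_self hα _ _ _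
  -- Equal images give an `eqToHom`, an inclusion; inside the ideal of `D` it must be induced by
  -- `A.gen` itself, which therefore lies in the left ideal of `B`.
  have hle : ∀ {A B D : LCat T}, IsSubobject A D → IsSubobject B D →
      (toDual hα).obj A = (toDual hα).obj B → A.gen * B.gen = A.gen := by
    intro A B D hA hB h
    obtain ⟨u, hu, h1⟩ := exists_eq_dualMap (he := A.gen_idem) (hf := B.gen_idem) hα (eqToHom h)
    have h2 := eq_of_isInclusion_dualMap hα (gen_mul_gen_of_isSubobject hA)
      (gen_mul_gen_of_isSubobject hB) D.gen_idem (h1 ▸ Dual.isInclusion_eqToHom h)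
    subst h2
    exact ((mem_sandwich_iff A.gen_idem B.gen_idem).mp hu).2
  refine ⟨inferInstance, inferInstance, hinc, hfull, hfaith, fun D =>
    isCatIso_restrictIdeal _ _ D (fun A B hA hB h => ?_) (fun X hX => ?_)⟩
  · rw [← of_gen A, ← of_gen B]
    exact of_eq_of _ _ (hle hA hB h) (hle hB hA h.symm)
  · obtain ⟨e, he, h1, rfl⟩ := exists_of_isSubobject_dualObj (hf := D.gen_idem) hα hX
    exact ⟨of e he, isSubobject_of_mul_gen he h1, toDual_obj_of hα he⟩

/-- The component at `Sk` is translation by `k α(e)`, and its inverse is translation by `v`. The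
resulting condition, that `v` is R-related to `α(e)` and L-related to `k`, is interchanged with its
mirror image by passing to the opposite semigroup. -/
lemma mem_MSet_toDual_iff (he : IsIdempotentElem e) {k : S} (hk : IsIdempotentElem k) :
    of k hk ∈ ((toDual hα).obj (of e he)).MSet ↔
      ∃ v, α e * v = v ∧ v * k = v ∧ k * v = k ∧ v * α e = α e := by
  rw [toDual_obj_of hα he, dualObj, Dual.mem_MSet_H_iff,
    rhoCone_comp_of (α e) (hα.idem he) k hk]
  refine isIso_rho_iff.trans ?_
  constructor
  · rintro ⟨v, hv, h1, h2⟩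
    obtain ⟨v1, v2⟩ := (mem_sandwich_iff (hα.idem he) hk).mp hv
    exact ⟨v, v1, v2, by rw [← v1, ← mul_assoc, h1], by rw [← v2, mul_assoc, h2]⟩
  · rintro ⟨v, v1, v2, h1, h2⟩
    exact ⟨v, (mem_sandwich_iff (hα.idem he) hk).mpr ⟨v1, v2⟩, by rw [mul_assoc, v1, h1],
      by rw [← mul_assoc, v2, h2]⟩

end LCat

end

end CrossConn

/-! ### The cross-connection of a locally inverse semigroup. -/

theorem mainTheorem7 (S : Type u) [Semigroup S] (hS : CrossConn.IsLocallyInverseSemigroup S) :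
    ∃ (_ : CrossConn.IsUnambiguous (CrossConn.LCat S))
      (_ : CrossConn.IsUnambiguous (CrossConn.RCat S))
      (Γ : CrossConn.RCat S ⥤ CrossConn.Dual (CrossConn.LCat S))
      (Δ : CrossConn.LCat S ⥤ CrossConn.Dual (CrossConn.RCat S)),
      CrossConn.IsGamma Γ ∧ CrossConn.IsDelta Δ ∧
        CrossConn.IsCrossConnection (CrossConn.LCat S) (CrossConn.RCat S) Γ Δ := by
  have hL : CrossConn.IsUnambiguous (CrossConn.LCat S) :=
    CrossConn.LCat.isUnambiguous hS.1 hS.locallyCommute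
  have hR : CrossConn.IsUnambiguous (CrossConn.RCat S) :=
    CrossConn.LCat.isUnambiguous hS.1.op hS.locallyCommute.op
  -- The two directions of the canonical anti-isomorphism between `S` and its opposite yield `Γ_S`
  -- and `Δ_S` respectively.
  have hα : CrossConn.LCat.IsAnti (opEquiv.symm : Sᵐᵒᵖ ≃ S) := fun _ _ => rfl
  have hβ : CrossConn.LCat.IsAnti (opEquiv : S ≃ Sᵐᵒᵖ) := fun _ _ => rfl
  refine ⟨hL, hR, CrossConn.LCat.toDual hα, CrossConn.LCat.toDual hβ,
    ⟨fun e he => CrossConn.LCat.toDual_obj_of hα _, fun e f he hf u hu =>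
      CrossConn.LCat.toDual_map_rho hα _ _ _ _⟩,
    ⟨fun e he => CrossConn.LCat.toDual_obj_of hβ he, fun e f he hf u hu =>
      CrossConn.LCat.toDual_map_rho hβ he hf u hu⟩,
    CrossConn.LCat.toDual_isLocalIsomorphism hα, CrossConn.LCat.toDual_isLocalIsomorphism hβ,
    fun c d => ?_⟩
  obtain ⟨g, hg, rfl⟩ := CrossConn.LCat.exists_eq_of c
  obtain ⟨e, he, rfl⟩ := CrossConn.LCat.exists_eq_of d
  rw [CrossConn.LCat.mem_MSet_toDual_iff hα he hg, CrossConn.LCat.mem_MSet_toDual_iff hβ hg he]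
  -- The same element `v` witnesses both memberships, with the roles of R and L exchanged by `op`.
  constructor
  · rintro ⟨v, h1, h2, h3, h4⟩
    exact ⟨op v, congrArg op h2, congrArg op h1, congrArg op h4, congrArg op h3⟩
  · rintro ⟨v, h1, h2, h3, h4⟩
    exact ⟨unop v, congrArg unop h2, congrArg unop h1, congrArg unop h4, congrArg unop h3⟩
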